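/- **Conventions.** Cardinals are identified with initial ordinals, and $+$, $\cdot$ and powers of ordinals denote ordinal arithmetic. For ordinals $\beta>1$ and $\gamma\ge 1$, $\log_\beta\gamma$ is the unique ordinal $\delta$ with $\gamma=\beta^{\delta}\cdot\zeta+\eta$, $1\le\zeta<\beta$, $\eta<\beta^{\delta}$. For a function $h$ from an ordinal $\lambda$ to the ordinals, $\sum h$ is the transfinite ordinal sum (partial sums are $0$ at $0$, add $h(\gamma)$ at the successor of $\gamma$, and are suprema at limits). For an ordinal $\alpha$ put $0\sim_\alpha 0$, and for $\beta,\gamma$ not both $0$ put $\beta\sim_\alpha\gamma$ iff $\beta<\gamma\cdot\aleph_\alpha$ and $\gamma<\beta\cdot\aleph_\alpha$; write $[\beta]_\alpha<[\gamma]_\alpha$ iff $\beta\not\sim_\alpha\gamma$ and $\beta<\gamma$. **Language.** Let $\mathbf P$ be a set of propositions. Formulas are $\phi::=p\mid\neg\phi\mid(\phi\wedge\phi)\mid\Box\phi\mid\boxplus\phi$ with $p\in\mathbf P$, where $\boxplus$ is a second modality. Degrees are $\deg p=0$, $\deg\neg\phi=\deg\phi$, $\deg(\phi\wedge\psi)=\max\{\deg\phi,\deg\psi\}$,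 $\deg\Box\phi=\deg\phi+1$, $\deg\boxplus\phi=\deg\phi+2$. **Models.** A Kripke model $\mathcal M=(S,R,V)$ consists of a non-empty set $S$, a relation $R\subseteq S\times S$ and $V:\mathbf P\to\mathcal P(S)$; its size is $|S|$. A pointed model $\mathcal M,s$ is *tree-like* if it is a tree with root $s$: every world is reachable from $s$ by finitely many (possibly zero) $R$-steps, $s$ has no $R$-predecessor, and no world has two distinct $R$-predecessors. Write $\kappa_s=|\{t:sRt\}|$ and $\lambda_s=|\{t:sRt,\ \exists u\ tRu\}|$. **Semantics.** Fix arbitrary bijections $f_s:\lambda_s\to\{t:sRt,\exists u\,tRu\}$ and $g_t:\kappa_t\to\{u:tRu\}$ for all worlds $s,t$. Atoms, $\neg$ and $\wedge$ are interpreted as usual. If $\kappa_s$ is infinite, $\mathcal M,s\vDash\Box\phi$ iff $|\{t:sRt,\ \mathcal M,t\vDash\phi\}|>|\{t:sRt,\ \mathcal M,t\nvDash\phi\}|$; if $\kappa_s$ is finite, $\mathcal M,s\vDash\Box\phi$ iff $\mathcal M,t\vDash\phi$ for all $t$ with $sRt$. For $\boxplus\phi$ and $\gamma<\lambda_s$ let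 $h(\gamma)=\kappa_{f_s(\gamma)}$, and let $h^{+}(\gamma)$ (resp. $h^-(\gamma)$) be the order type, in the well-order given by $g_{f_s(\gamma)}$, of the set of successors of $f_s(\gamma)$ at which $\phi$ holds (resp. fails). If $|\sum h|=\aleph_\zeta$ is infinite, $\mathcal M,s\vDash\boxplus\phi$ iff $[\sum h^+]_\zeta>[\sum h^-]_\zeta$; otherwise $\mathcal M,s\vDash\boxplus\phi$ iff $\mathcal M,u\vDash\phi$ for all $t,u$ with $sRt$, $tRu$. **Modal equivalence.** For $k\in\omega$ and ordinals $\alpha,\beta$, the pointed models $\mathcal M,s$ and $\mathcal N,w$ are $(k,\alpha,\beta)$-modal-equivalent if (i) $\mathcal M,s\vDash\phi\iff\mathcal N,w\vDash\phi$ for every formula $\phi$ with $\deg\phi\le k$, and (ii) for every formula $\phi$ with $\deg\phi<k$, either neither $s$ nor $w$ has a successor satisfying $\phi$, or both have one and $$\log_{\aleph_\alpha}|\{t:t\text{ is a successor of }s,\ \mathcal M,t\vDash\phi\}|=\log_{\aleph_\beta}|\{v:v\text{ is a successor of }w,\ \mathcal N,v\vDash\phi\}|.$$ **Theorem.** Assume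 that $\mathbf P$ is finite. Let $\mathcal M,s$ be a tree-like pointed model such that for every world $x$ the cardinal $|\{u:\exists t\ (xRt\wedge tRu)\}|$ is finite or regular. Let $k\in\omega$ and let $\alpha$ be an ordinal with $|\{t:sRt\}|\le\aleph_\alpha$. Then there exists $m\in\omega$ such that for every $n\in\omega$ with $n\ge m$ there exists a tree-like pointed model $\mathcal N_n,w$ of size smaller than $\aleph_\omega$ such that, for every choice of the bijections in the semantics of $\mathcal M$ and of $\mathcal N_n$, the pointed models $\mathcal M,s$ and $\mathcal N_n,w$ are $(k,\alpha,n)$-modal-equivalent. -/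

import Mathlib

open Cardinal Ordinal

universe u v

namespace TransfiniteModal

/-! ### Ordinal arithmetic -/

/-- The relation `β ∼_α γ` on ordinals. -/
def OrdSim (α β γ : Ordinal.{u}) : Prop :=
  (β = 0 ∧ γ = 0) ∨ ((0 < β ∨ 0 < γ) ∧ β < γ * ω_ α ∧ γ < β * ω_ α)

/-- The order `[β]_α < [γ]_α` of equivalence classes modulo `∼_α`, on representatives. -/
def ClassLT (α β γ : Ordinal.{u}) : Prop :=
  ¬ OrdSim α β γ ∧ β < γ

/-- The partial sums of a transfinite sequence `f` of ordinals:
`0` at `0`, add `f γ` at the successor of `γ`, take the supremum at limits. -/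
noncomputable def partialSum (f : Ordinal.{u} → Ordinal.{u}) (β : Ordinal.{u}) : Ordinal.{u} :=
  Ordinal.limitRecOn β 0 (fun γ S => S + f γ) (fun β _ S => ⨆ γ : Set.Iio β, S γ.1 γ.2)

open Classical in
/-- The transfinite ordinal sum of a function `f : α → Ord`. (The values of the extension
outside `α` are never used.) -/
noncomputable def ordSum {α : Ordinal.{u}} (f : Set.Iio α → Ordinal.{u}) : Ordinal.{u} :=
  partialSum (fun γ => if h : γ < α then f ⟨γ, h⟩ else 0) α

theorem partialSum_zero (f : Ordinal.{u} → Ordinal.{u}) : partialSum f 0 = 0 := by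
  simp [partialSum]

theorem partialSum_succ (f : Ordinal.{u} → Ordinal.{u}) (γ : Ordinal.{u}) :
    partialSum f (Order.succ γ) = partialSum f γ + f γ := by
  simp [partialSum]

theorem partialSum_limit (f : Ordinal.{u} → Ordinal.{u}) {β : Ordinal.{u}}
    (hβ : Order.IsSuccLimit β) :
    partialSum f β = ⨆ γ : Set.Iio β, partialSum f γ.1 := by
  simp [partialSum, Ordinal.limitRecOn_limit, hβ]

/-! ### Syntax -/

/-- Formulas of duplex transfinite modal logic over the propositions `P`. -/
inductive Formula (P : Type v) : Type v
  | atom : P → Formula P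
  | neg : Formula P → Formula P
  | and : Formula P → Formula P → Formula P
  | box : Formula P → Formula P
  | boxbox : Formula P → Formula P

/-- The degree of a formula. -/
def Formula.deg {P : Type v} : Formula P → ℕ
  | .atom _ => 0
  | .neg φ => φ.deg
  | .and φ ψ => max φ.deg ψ.deg
  | .box φ => φ.deg + 1
  | .boxbox φ => φ.deg + 2

/-! ### Kripke models -/

/-- A Kripke model over the propositions `P`. -/
structure KripkeModel (P : Type v) where
  /-- the possible worlds -/
  World : Type u
  nonempty : Nonempty World
  /-- the accessibility relation -/
  R : World → World → Prop
  /-- the valuation -/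
  V : P → Set World

namespace KripkeModel

variable {P : Type v}

/-- The successors of `s`. -/
def succs (M : KripkeModel.{u, v} P) (s : M.World) : Set M.World := {t | M.R s t}

/-- The live successors of `s`: those that have a successor themselves. -/
def liveSuccs (M : KripkeModel.{u, v} P) (s : M.World) : Set M.World :=
  {t | M.R s t ∧ ∃ u, M.R t u}

/-- The successors of successors of `s`. -/
def grandSuccs (M : KripkeModel.{u, v} P) (s : M.World) : Set M.World :=
  {u | ∃ t, M.R s t ∧ M.R t u}

/-- `M, s` is tree-like: `M` is a tree with root `s`. Every world is reached from `s`, the root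
has no predecessor, and no world has two predecessors. -/
structure IsTreeLike (M : KripkeModel.{u, v} P) (s : M.World) : Prop where
  reachable : ∀ x, Relation.ReflTransGen M.R s x
  root : ∀ x, ¬ M.R x s
  unique_pred : ∀ x y z, M.R x z → M.R y z → x = y

/-- The number of grandsuccessors of any world of `M` is finite or a regular cardinal. -/
def HasRegularCards (M : KripkeModel.{u, v} P) : Prop :=
  ∀ x : M.World, ℵ₀ ≤ #(M.grandSuccs x) → (#(M.grandSuccs x)).IsRegular

/-- The arbitrary bijections on which the semantics of `boxbox` is built: `f s` enumerates the
live successors of `s` along the cardinal `λ_s`, and `g t` enumerates the successors of `t` along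
the cardinal `κ_t` (cardinals being initial ordinals). -/
structure Enumeration (M : KripkeModel.{u, v} P) where
  f : ∀ s : M.World, Set.Iio (#(M.liveSuccs s)).ord ≃ M.liveSuccs s
  g : ∀ t : M.World, Set.Iio (#(M.succs t)).ord ≃ M.succs t

theorem nonempty_equiv_ord {X : Type u} : Nonempty (Set.Iio (#X).ord ≃ X) := by
  apply Cardinal.lift_mk_eq'.1
  simp [Cardinal.mk_Iio_ordinal]

theorem nonempty_enumeration (M : KripkeModel.{u, v} P) : Nonempty M.Enumeration :=
  ⟨⟨fun _ => nonempty_equiv_ord.some, fun _ => nonempty_equiv_ord.some⟩⟩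

namespace Enumeration

variable {M : KripkeModel.{u, v} P}

/-- The order of the successors of `t` that satisfy `Q`, inherited from the enumeration `g t`. -/
def succLT (e : M.Enumeration) (t : M.World) (Q : M.World → Prop) :
    {x : M.succs t // Q x} → {x : M.succs t // Q x} → Prop :=
  (fun x : {x : M.succs t // Q x} => (e.g t).symm x.1) ⁻¹'o (· < ·)

instance (e : M.Enumeration) (t : M.World) (Q : M.World → Prop) :
    IsWellOrder _ (e.succLT t Q) :=
  (RelEmbedding.preimage
    (⟨fun x : {x : M.succs t // Q x} => (e.g t).symm x.1,
      (e.g t).symm.injective.comp Subtype.val_injective⟩ :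
        {x : M.succs t // Q x} ↪ Set.Iio (#(M.succs t)).ord)
    (· < ·)).isWellOrder

/-- The function `h : λ_s → Ord`, `h γ = κ_{f_s γ}`. -/
noncomputable def h (e : M.Enumeration) (s : M.World) :
    Set.Iio (#(M.liveSuccs s)).ord → Ordinal.{u} :=
  fun γ => (#(M.succs (e.f s γ))).ord

/-- The function `λ_s → Ord` that sends `γ` to the order type, under `g_{f_s γ}`, of the successors
of `f_s γ` that satisfy `Q`. -/
noncomputable def hOf (e : M.Enumeration) (s : M.World) (Q : M.World → Prop) :
    Set.Iio (#(M.liveSuccs s)).ord → Ordinal.{u} :=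
  fun γ => Ordinal.type (e.succLT (e.f s γ) Q)

end Enumeration

/-- Satisfaction of formulas at worlds of `M`, for the choice `e` of bijections. -/
def Sat (M : KripkeModel.{u, v} P) (e : M.Enumeration) : Formula P → M.World → Prop
  | .atom p, s => s ∈ M.V p
  | .neg φ, s => ¬ M.Sat e φ s
  | .and φ ψ, s => M.Sat e φ s ∧ M.Sat e ψ s
  | .box φ, s =>
      (ℵ₀ ≤ #(M.succs s) ∧
        #{t : M.World // M.R s t ∧ ¬ M.Sat e φ t} < #{t : M.World // M.R s t ∧ M.Sat e φ t}) ∨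
      (#(M.succs s) < ℵ₀ ∧ ∀ t, M.R s t → M.Sat e φ t)
  | .boxbox φ, s =>
      (∃ ζ : Ordinal.{u}, (ordSum (e.h s)).card = ℵ_ ζ ∧
        ClassLT ζ (ordSum (e.hOf s fun x => ¬ M.Sat e φ x))
          (ordSum (e.hOf s fun x => M.Sat e φ x))) ∨
      ((ordSum (e.h s)).card < ℵ₀ ∧ ∀ t x, M.R s t → M.R t x → M.Sat e φ x)

/-- The pointed models `M, s` and `N, w` are `(k, α, β)`-modal-equivalent. -/
def ModalEquiv (k : ℕ) (α β : Ordinal.{u})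
    (M : KripkeModel.{u, v} P) (e : M.Enumeration) (s : M.World)
    (N : KripkeModel.{u, v} P) (e' : N.Enumeration) (w : N.World) : Prop :=
  (∀ φ : Formula P, φ.deg ≤ k → (M.Sat e φ s ↔ N.Sat e' φ w)) ∧
  ∀ φ : Formula P, φ.deg < k →
    ((¬ ∃ t, M.R s t ∧ M.Sat e φ t) ∧ (¬ ∃ x, N.R w x ∧ N.Sat e' φ x)) ∨
    ((∃ t, M.R s t ∧ M.Sat e φ t) ∧ (∃ x, N.R w x ∧ N.Sat e' φ x) ∧
      Ordinal.log (ω_ α) (#{t : M.World // M.R s t ∧ M.Sat e φ t}).ord =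
        Ordinal.log (ω_ β) (#{x : N.World // N.R w x ∧ N.Sat e' φ x}).ord)

end KripkeModel

end TransfiniteModal

namespace TransfiniteModal

/-! ### Partial sums -/

/-! Satisfaction does not depend on the bijections. If a world has a regular number `ℵ_ ζ` of
grandsuccessors, the sums that interpret `boxbox` lie below `ω_ ζ ^ 3`, where the classes modulo
`∼_ζ` are `{0}` and the intervals `[ω_ ζ ^ i, ω_ ζ ^ (i + 1))`. Regularity makes the class of a sum
a matter of cardinalities alone: are there `ℵ_ ζ` successors each with `ℵ_ ζ` good successors, and
if not, is there one such, or are there `ℵ_ ζ` successors with at least one good successor, and so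
on. The answer is the number `level`, and `sat_iff_holds` replaces `Sat` by the bijection-free
`Holds`.

As `P` is finite, there are finitely many formulas of bounded degree up to equivalence in `M`, so
the successors of a world fall into finitely many types. Only comparisons between the finitely many
sizes of unions of types, and with `ℵ_ α` and `ℵ_ ζ`, then matter. The map `collapse` sends all
these cardinals below `ℵ_ ω`, respecting order and sums and keeping finite cardinals.

The small model is built by induction on `k` (`exists_agree`): each type is represented by a small
model, and a new root receives a collapsed number of copies of each representative
(`exists_agree_of_types`). That `k`-agreement at the successors gives `(k+1)`-agreement at the root
is `Matching.agree`. Every infinite cardinal below `ℵ_ ω` is regular, so `sat_iff_holds` applies to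
the small model too. Finally, a number of successors is at most `ℵ_ α`, so its logarithm is `0` or
`1` and records only whether it reaches `ℵ_ α`. -/

@[elab_as_elim]
theorem limitInduction {motive : Ordinal.{u} → Prop} (o : Ordinal.{u}) (zero : motive 0)
    (succ : ∀ o, motive o → motive (Order.succ o))
    (limit : ∀ o, Order.IsSuccLimit o → (∀ a < o, motive a) → motive o) : motive o :=
  Ordinal.limitRecOn o zero succ limit

section PartialSum

variable {f : Ordinal.{u} → Ordinal.{u}}

theorem partialSum_le_of_isSuccLimit {β γ : Ordinal.{u}} (hβ : Order.IsSuccLimit β) (h : γ < β) :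
    partialSum f γ ≤ partialSum f β := by
  rw [partialSum_limit f hβ]
  exact Ordinal.le_iSup (fun γ : Set.Iio β => partialSum f γ.1) ⟨γ, h⟩

theorem partialSum_limit_le {β x : Ordinal.{u}} (hβ : Order.IsSuccLimit β)
    (h : ∀ γ < β, partialSum f γ ≤ x) : partialSum f β ≤ x := by
  rw [partialSum_limit f hβ]
  exact Ordinal.iSup_le fun γ => h γ.1 γ.2

theorem partialSum_mono : Monotone (partialSum f) := by
  intro γ β
  induction β using limitInduction with
  | zero => intro h; rw [nonpos_iff_eq_zero.1 h]
  | succ β ih =>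
    intro h
    rcases h.eq_or_lt with rfl | h
    · exact le_rfl
    · rw [partialSum_succ]
      exact (ih (Order.lt_succ_iff.1 h)).trans le_self_add
  | limit β hβ ih =>
    intro h
    rcases h.eq_or_lt with rfl | h
    · exact le_rfl
    · exact partialSum_le_of_isSuccLimit hβ h

theorem le_partialSum {β γ : Ordinal.{u}} (h : γ < β) : f γ ≤ partialSum f β := by
  refine le_trans ?_ (partialSum_mono (Order.succ_le_of_lt h))
  rw [partialSum_succ]
  exact le_add_self

theorem partialSum_le_of_forall_eq_zero {δ β : Ordinal.{u}}
    (h : ∀ γ, δ ≤ γ → γ < β → f γ = 0) : partialSum f β ≤ partialSum f δ := by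
  induction β using limitInduction with
  | zero => exact partialSum_mono zero_le
  | succ β ih =>
    rcases le_or_gt δ β with hδ | hδ
    · rw [partialSum_succ, h β hδ (Order.lt_succ β), add_zero]
      exact ih fun γ h1 h2 => h γ h1 (h2.trans (Order.lt_succ β))
    · exact partialSum_mono (Order.succ_le_of_lt hδ)
  | limit β hβ ih =>
    exact partialSum_limit_le hβ fun γ hγ => ih γ hγ fun η h1 h2 => h η h1 (h2.trans hγ)

theorem partialSum_le_mul {x β : Ordinal.{u}} (h : ∀ γ < β, f γ ≤ x) :
    partialSum f β ≤ x * β := by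
  induction β using limitInduction with
  | zero => simp [partialSum_zero]
  | succ β ih =>
    rw [partialSum_succ, Ordinal.mul_succ]
    exact add_le_add (ih fun γ h2 => h γ (h2.trans (Order.lt_succ β))) (h β (Order.lt_succ β))
  | limit β hβ ih =>
    exact partialSum_limit_le hβ fun γ hγ =>
      (ih γ hγ fun η h2 => h η (h2.trans hγ)).trans (mul_le_mul_right hγ.le x)

variable {c : Cardinal.{u}}

theorem iSup_Iio_lt_ord (hc : c.IsRegular) {β : Ordinal.{u}} (hβ : β < c.ord)
    {g : Ordinal.{u} → Ordinal.{u}} (h : ∀ γ < β, g γ < c.ord) :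
    ⨆ γ : Set.Iio β, g γ.1 < c.ord := by
  apply Ordinal.lift_iSup_lt_of_lt_cof
  · rw [Cardinal.mk_Iio_ordinal, ← Ordinal.lift_cof, hc.cof_ord]
    simpa [← Ordinal.lift_card] using Cardinal.lt_ord.1 hβ
  · exact fun γ => h γ.1 γ.2

/-- A sum of fewer than `c` terms below `c.ord` stays below `c.ord`: successor stages use that
`c.ord` is additively principal, limit stages that `c` is regular. The induction runs on the left
difference from `partialSum f δ`, since terms before `δ` may be large. -/
theorem partialSum_sub_lt (hc : c.IsRegular) {δ β : Ordinal.{u}} (hβ : β < c.ord)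
    (h : ∀ γ, δ ≤ γ → γ < β → f γ < c.ord) :
    ∃ ρ < c.ord, partialSum f β ≤ partialSum f δ + ρ := by
  suffices H : partialSum f β - partialSum f δ < c.ord from
    ⟨_, H, Ordinal.le_add_sub _ _⟩
  induction β using limitInduction with
  | zero => simpa [partialSum_zero] using hc.ord_pos
  | succ β ih =>
    have hβ' := (Order.lt_succ β).trans hβ
    rcases le_or_gt δ β with hδ | hδ
    · have h1 := ih hβ' fun γ h1 h2 => h γ h1 (h2.trans (Order.lt_succ β))
      have h2 := h β hδ (Order.lt_succ β)
      rw [partialSum_succ]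
      refine (Ordinal.sub_le.2 ?_).trans_lt (isPrincipal_add_ord hc.aleph0_le h1 h2)
      simp only
      rw [← add_assoc]
      gcongr
      exact Ordinal.le_add_sub _ _
    · rw [Ordinal.sub_eq_zero_iff_le.2 (partialSum_mono (Order.succ_le_of_lt hδ))]
      exact hc.ord_pos
  | limit β hβl ih =>
    refine lt_of_le_of_lt (Ordinal.sub_le.2 (partialSum_limit_le hβl fun γ hγ => ?_))
      (iSup_Iio_lt_ord hc hβ (g := fun γ => partialSum f γ - partialSum f δ)
        fun γ hγ => ih γ hγ (hγ.trans hβ) fun η h1 h2 => h η h1 (h2.trans hγ))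
    refine (Ordinal.le_add_sub _ (partialSum f δ)).trans ?_
    gcongr
    exact Ordinal.le_iSup (fun γ : Set.Iio β => partialSum f γ.1 - partialSum f δ) ⟨γ, hγ⟩

theorem isSuccLimit_ord_of_isRegular (hc : c.IsRegular) : Order.IsSuccLimit c.ord :=
  Cardinal.isSuccLimit_ord hc.aleph0_le

theorem partialSum_lt_ord (hc : c.IsRegular) {Λ δ : Ordinal.{u}} (hδ : δ < c.ord)
    (h0 : ∀ γ, δ ≤ γ → γ < Λ → f γ = 0) (hf : ∀ γ < Λ, f γ < c.ord) :
    partialSum f Λ < c.ord := by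
  rcases le_total δ Λ with hδΛ | hδΛ
  · obtain ⟨ρ, hρ, hle⟩ := partialSum_sub_lt (f := f) (δ := 0) hc hδ
      fun γ _ h => hf γ (h.trans_le hδΛ)
    rw [partialSum_zero, zero_add] at hle
    exact (partialSum_le_of_forall_eq_zero h0).trans_lt (hle.trans_lt hρ)
  · obtain ⟨ρ, hρ, hle⟩ := partialSum_sub_lt (f := f) (δ := 0) hc (hδΛ.trans_lt hδ)
      fun γ _ h => hf γ h
    rw [partialSum_zero, zero_add] at hle
    exact hle.trans_lt hρ

/-- The terms before `δ` add up to at most `c.ord * δ` and the tail adds at most `c.ord`, which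
gives at most `c.ord * (δ + 1)`. -/
theorem partialSum_lt_ord_mul_ord (hc : c.IsRegular) {Λ δ : Ordinal.{u}} (hΛ : Λ ≤ c.ord)
    (hδ : δ < c.ord) (hlt : ∀ γ, δ ≤ γ → γ < Λ → f γ < c.ord) (hf : ∀ γ < Λ, f γ ≤ c.ord) :
    partialSum f Λ < c.ord * c.ord := by
  have hpos : 0 < c.ord := hc.ord_pos
  rcases le_total δ Λ with hδΛ | hδΛ
  · have h1 : partialSum f Λ ≤ partialSum f δ + c.ord := by
      rcases hΛ.eq_or_lt with rfl | hΛ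
      · refine partialSum_limit_le (isSuccLimit_ord_of_isRegular hc) fun γ hγ => ?_
        obtain ⟨ρ, hρ, hle⟩ := partialSum_sub_lt (f := f) (δ := δ) hc hγ
          fun η h1 h2 => hlt η h1 (h2.trans hγ)
        exact hle.trans (by gcongr)
      · obtain ⟨ρ, hρ, hle⟩ := partialSum_sub_lt (f := f) (δ := δ) hc hΛ hlt
        exact hle.trans (by gcongr)
    refine h1.trans_lt ?_
    have h2 : partialSum f δ ≤ c.ord * δ := partialSum_le_mul fun γ h => hf γ (h.trans_le hδΛ)
    calc partialSum f δ + c.ord ≤ c.ord * δ + c.ord := by gcongr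
      _ = c.ord * Order.succ δ := (Ordinal.mul_succ _ _).symm
      _ < c.ord * c.ord :=
        (mul_lt_mul_iff_right₀ hpos).2 ((isSuccLimit_ord_of_isRegular hc).succ_lt hδ)
  · refine (partialSum_le_mul hf).trans_lt ?_
    exact (mul_lt_mul_iff_right₀ hpos).2 (hδΛ.trans_lt hδ)

/-- Terms of size at least `a` occur cofinally, so any `ξ < c.ord` of them fit below some index `β <
Λ`. -/
theorem mul_ord_le_partialSum (hc : c.IsRegular) {Λ a : Ordinal.{u}} (hΛ : Λ ≤ c.ord)
    (h : ∀ δ < c.ord, ∃ γ < Λ, δ ≤ γ ∧ a ≤ f γ) : a * c.ord ≤ partialSum f Λ := by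
  have key : ∀ ξ < c.ord, ∃ β < Λ, a * ξ ≤ partialSum f β := by
    intro ξ
    induction ξ using limitInduction with
    | zero =>
      intro h0
      obtain ⟨γ, hγ, -⟩ := h 0 h0
      exact ⟨γ, hγ, by simp⟩
    | succ ξ ih =>
      intro hξ
      obtain ⟨β, hβ, hle⟩ := ih ((Order.lt_succ ξ).trans hξ)
      obtain ⟨γ, hγ, hβγ, ha⟩ := h β (hβ.trans_le hΛ)
      -- The term at `γ` is included only in partial sums beyond `γ`, so a further index below `Λ`
      -- is needed.
      obtain ⟨γ', hγ', hγγ', -⟩ := h (Order.succ γ)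
        ((isSuccLimit_ord_of_isRegular hc).succ_lt (hγ.trans_le hΛ))
      refine ⟨γ', hγ', le_trans ?_ (partialSum_mono hγγ')⟩
      rw [partialSum_succ, Ordinal.mul_succ]
      exact add_le_add (hle.trans (partialSum_mono hβγ)) ha
    | limit ξ hξl ih =>
      intro hξ
      have ih' : ∀ η, ∃ β, η < ξ → β < Λ ∧ a * η ≤ partialSum f β := by
        intro η
        by_cases hη : η < ξ
        · obtain ⟨β, h1, h2⟩ := ih η hη (hη.trans hξ)
          exact ⟨β, fun _ => ⟨h1, h2⟩⟩
        · exact ⟨0, fun h => absurd h hη⟩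
      -- By regularity the indices found for all `η < ξ` have a supremum below `c.ord`, and an index
      -- past it serves for `ξ`.
      choose g hg using ih'
      obtain ⟨γ, hγ, hle, -⟩ := h _ (iSup_Iio_lt_ord hc hξ (g := g)
        fun η hη => (hg η hη).1.trans_le hΛ)
      refine ⟨γ, hγ, (Ordinal.mul_le_iff_of_isSuccLimit hξl).2 fun η hη => ?_⟩
      refine (hg η hη).2.trans (partialSum_mono (le_trans ?_ hle))
      exact Ordinal.le_iSup (fun γ : Set.Iio ξ => g γ.1) ⟨η, hη⟩
  refine (Ordinal.mul_le_iff_of_isSuccLimit (isSuccLimit_ord_of_isRegular hc)).2 fun ξ hξ => ?_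
  obtain ⟨β, hβ, hle⟩ := key ξ hξ
  exact hle.trans (partialSum_mono hβ.le)

end PartialSum

/-! ### The classes of ordinals below `ω_ ζ ^ 3` -/

/-- The least ordinal of the class number `i` modulo `∼_ζ`. -/
noncomputable def classMin (ζ : Ordinal.{u}) : ℕ → Ordinal.{u}
  | 0 => 0
  | i + 1 => ω_ ζ ^ i

theorem classMin_mono (ζ : Ordinal.{u}) : Monotone (classMin ζ) := by
  refine monotone_nat_of_le_succ fun i => ?_
  cases i with
  | zero => exact zero_le
  | succ i =>
    simp only [classMin, pow_succ]
    exact le_mul_of_one_le_right zero_le (Order.one_le_iff_pos.2 (omega_pos ζ))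

/-- Dividing by `ω_ ζ ^ i` bounds `a` by `ω_ ζ ^ i * succ q` with `q < ω_ ζ`, and `succ q * ω_ ζ ≤
ω_ ζ` because `ω_ ζ` is multiplicatively principal. -/
theorem mul_omega_le_classMin {ζ a : Ordinal.{u}} {i : ℕ} (h : a < classMin ζ (i + 1)) :
    a * ω_ ζ ≤ classMin ζ (i + 1) := by
  cases i with
  | zero =>
    have : a = 0 := by simpa [classMin] using h
    simp [this]
  | succ i =>
    have hpos : 0 < ω_ ζ ^ i := pow_pos (omega_pos ζ) i
    simp only [classMin, pow_succ] at h ⊢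
    have hdiv : a / ω_ ζ ^ i < ω_ ζ := (Ordinal.lt_mul_iff_div_lt hpos.ne').1 h
    have hlim : Order.IsSuccLimit (ω_ ζ) := isSuccLimit_omega ζ
    calc a * ω_ ζ ≤ (ω_ ζ ^ i * Order.succ (a / ω_ ζ ^ i)) * ω_ ζ := by
          gcongr
          exact (Ordinal.lt_mul_succ_div a hpos.ne').le
      _ = ω_ ζ ^ i * (Order.succ (a / ω_ ζ ^ i) * ω_ ζ) := mul_assoc _ _ _
      _ ≤ ω_ ζ ^ i * ω_ ζ := by
          gcongr
          refine (Ordinal.mul_le_iff_of_isSuccLimit hlim).2 fun η hη => le_of_lt ?_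
          have := isPrincipal_mul_ord (aleph0_le_aleph ζ)
          rw [ord_aleph] at this
          exact this (hlim.succ_lt hdiv) hη

theorem classLT_iff {ζ a b : Ordinal.{u}} {i j : ℕ}
    (ha : classMin ζ i ≤ a) (ha' : a < classMin ζ (i + 1))
    (hb : classMin ζ j ≤ b) (hb' : b < classMin ζ (j + 1)) :
    ClassLT ζ a b ↔ i < j := by
  have key : ∀ {a b : Ordinal.{u}} {i j : ℕ}, a < classMin ζ (i + 1) → classMin ζ j ≤ b → i < j →
      a * ω_ ζ ≤ b := fun ha' hb hij =>
    (mul_omega_le_classMin ha').trans ((classMin_mono ζ hij).trans hb)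
  have hω : 1 < ω_ ζ := one_lt_omega0.trans_le (omega0_le_omega ζ)
  constructor
  · rintro ⟨hns, hlt⟩
    by_contra hij
    rcases (not_lt.1 hij).eq_or_lt with rfl | hij
    · refine hns ?_
      cases j with
      | zero => simp [classMin] at ha' hb'; exact Or.inl ⟨ha', hb'⟩
      | succ j =>
        have hpos : 0 < ω_ ζ ^ j := pow_pos (omega_pos ζ) j
        simp only [classMin, pow_succ] at *
        refine Or.inr ⟨Or.inl (hpos.trans_le ha), ha'.trans_le ?_, hb'.trans_le ?_⟩ <;> gcongr
    · have h1 := key hb' ha hij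
      have h2 : b ≤ b * ω_ ζ := le_mul_of_one_le_right zero_le hω.le
      exact absurd (hlt.trans_le (h2.trans h1)) (lt_irrefl _)
  · intro hij
    have h1 := key ha' hb hij
    have h2 : a < b := ha'.trans_le ((classMin_mono ζ hij).trans hb)
    refine ⟨?_, h2⟩
    rintro (⟨rfl, rfl⟩ | ⟨-, -, h⟩)
    · exact lt_irrefl _ h2
    · exact absurd (h.trans_le h1) (lt_irrefl _)

namespace KripkeModel

variable {P : Type v} (M : KripkeModel.{u, v} P)

/-! ### A semantics that does not refer to enumerations -/

/-- The number of successors of `s` that satisfy `Q`. -/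
def count (s : M.World) (Q : M.World → Prop) : Cardinal.{u} :=
  #{t : M.World // M.R s t ∧ Q t}

open Classical in
/-- For a world `s` whose number of grandsuccessors is a regular cardinal `ℵ_ ζ`, the number of the
class modulo `∼_ζ` of the ordinal sum that counts the grandsuccessors of `s` satisfying `Q`. -/
noncomputable def level (s : M.World) (Q : M.World → Prop) : ℕ :=
  if #(M.grandSuccs s) ≤ M.count s (fun t => #(M.grandSuccs s) ≤ M.count t Q) then 3
  else if (∃ t, M.R s t ∧ #(M.grandSuccs s) ≤ M.count t Q) ∨
    #(M.grandSuccs s) ≤ M.count s (fun t => ∃ x, M.R t x ∧ Q x) then 2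
  else if ∃ t, M.R s t ∧ ∃ x, M.R t x ∧ Q x then 1
  else 0

/-- Satisfaction of formulas, with `boxbox` interpreted by the comparison of levels. -/
def Holds : Formula P → M.World → Prop
  | .atom p, s => s ∈ M.V p
  | .neg φ, s => ¬ Holds φ s
  | .and φ ψ, s => Holds φ s ∧ Holds ψ s
  | .box φ, s =>
      (ℵ₀ ≤ #(M.succs s) ∧ M.count s (fun t => ¬ Holds φ t) < M.count s (Holds φ)) ∨
      (#(M.succs s) < ℵ₀ ∧ ∀ t, M.R s t → Holds φ t)
  | .boxbox φ, s =>
      (ℵ₀ ≤ #(M.grandSuccs s) ∧ M.level s (fun x => ¬ Holds φ x) < M.level s (Holds φ)) ∨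
      (#(M.grandSuccs s) < ℵ₀ ∧ ∀ t x, M.R s t → M.R t x → Holds φ x)

variable {M}

theorem count_le_succs (s : M.World) (Q : M.World → Prop) : M.count s Q ≤ #(M.succs s) :=
  Cardinal.mk_subtype_le_of_subset fun _ h => h.1

theorem count_true (s : M.World) : M.count s (fun _ => True) = #(M.succs s) := by
  simp [count, succs, Set.coe_ofPred]

theorem count_eq_zero {s : M.World} {Q : M.World → Prop} :
    M.count s Q = 0 ↔ ∀ t, M.R s t → ¬ Q t := by
  simp [count, Cardinal.mk_eq_zero_iff, isEmpty_subtype]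

theorem count_ne_zero {s : M.World} {Q : M.World → Prop} :
    M.count s Q ≠ 0 ↔ ∃ t, M.R s t ∧ Q t := by
  simp [count_eq_zero]

theorem count_eq_mk_succs (s : M.World) (Q : M.World → Prop) :
    M.count s Q = #{t : M.succs s // Q t.1} :=
  Cardinal.mk_congr (Equiv.subtypeSubtypeEquivSubtypeInter (· ∈ M.succs s) Q).symm

theorem mk_succs_le_mk_grandSuccs {s t : M.World} (h : M.R s t) :
    #(M.succs t) ≤ #(M.grandSuccs s) :=
  Cardinal.mk_le_mk_of_subset fun _ hx => ⟨t, h, hx⟩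

theorem mk_liveSuccs_le_mk_grandSuccs (hu : ∀ x y z, M.R x z → M.R y z → x = y) (s : M.World) :
    #(M.liveSuccs s) ≤ #(M.grandSuccs s) := by
  choose g hg using fun t : M.liveSuccs s => t.2.2
  refine Cardinal.mk_le_of_injective (f := fun t => ⟨g t, t.1, t.2.1, hg t⟩) fun t t' h => ?_
  have h' : g t = g t' := congrArg Subtype.val h
  exact Subtype.ext (hu _ _ _ (hg t) (h' ▸ hg t'))

theorem grandSuccs_eq_iUnion (s : M.World) :
    M.grandSuccs s = ⋃ t : M.liveSuccs s, M.succs t.1 := by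
  ext x
  simp only [grandSuccs, liveSuccs, succs, Set.mem_ofPred_eq, Set.mem_iUnion, Subtype.exists,
    exists_prop]
  exact ⟨fun ⟨t, h, h'⟩ => ⟨t, ⟨h, x, h'⟩, h'⟩, fun ⟨t, h, h'⟩ => ⟨t, h.1, h'⟩⟩

theorem mk_grandSuccs_le_mul {s : M.World} {c : Cardinal.{u}}
    (h : ∀ t, M.R s t → #(M.succs t) ≤ c) : #(M.grandSuccs s) ≤ #(M.liveSuccs s) * c := by
  rw [grandSuccs_eq_iUnion]
  refine (Cardinal.mk_iUnion_le _).trans ?_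
  gcongr
  exact ciSup_le' fun t => h t.1 t.2.1

/-- A regular cardinal is not the size of a union of fewer, smaller sets. -/
theorem exists_le_mk_succs_or_le_mk_liveSuccs {s : M.World}
    (h : (#(M.grandSuccs s)).IsRegular) :
    (∃ t, M.R s t ∧ #(M.grandSuccs s) ≤ #(M.succs t)) ∨
      #(M.grandSuccs s) ≤ #(M.liveSuccs s) := by
  by_contra! H
  have := (Cardinal.card_iUnion_lt_iff_forall_of_isRegular h H.2
    (t := fun t : M.liveSuccs s => M.succs t.1)).2 fun t => H.1 t.1 t.2.1
  rw [← grandSuccs_eq_iUnion] at this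
  exact lt_irrefl _ this

theorem mk_grandSuccs_lt_aleph0_iff (hu : ∀ x y z, M.R x z → M.R y z → x = y) (s : M.World) :
    #(M.grandSuccs s) < ℵ₀ ↔
      #(M.liveSuccs s) < ℵ₀ ∧ ∀ t, M.R s t → #(M.succs t) < ℵ₀ := by
  constructor
  · exact fun h => ⟨(mk_liveSuccs_le_mk_grandSuccs hu s).trans_lt h,
      fun t ht => (mk_succs_le_mk_grandSuccs ht).trans_lt h⟩
  · rintro ⟨h1, h2⟩
    rw [grandSuccs_eq_iUnion]
    exact (Cardinal.card_iUnion_lt_iff_forall_of_isRegular isRegular_aleph0 h1).2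
      fun t => h2 t.1 t.2.1

/-! ### Ordinal sums along an enumeration -/

namespace Enumeration

variable (e : M.Enumeration) {s : M.World}

/-- Otherwise all `c` successors with `p` would be enumerated before `δ`, where there are fewer than
`c` places. They are enumerated at all because `hp` makes them live. -/
theorem exists_le_of_le_count {p : M.World → Prop} {c : Cardinal.{u}}
    (hp : ∀ t, p t → ∃ x, M.R t x) (h : c ≤ M.count s p) {δ : Ordinal.{u}} (hδ : δ < c.ord) :
    ∃ γ : Set.Iio (#(M.liveSuccs s)).ord, δ ≤ γ.1 ∧ p (e.f s γ) := by
  by_contra! H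
  let g : {t : M.World // M.R s t ∧ p t} → Set.Iio δ := fun t =>
    ⟨((e.f s).symm ⟨t.1, t.2.1, hp _ t.2.2⟩).1, by
      by_contra hlt
      refine H _ (not_lt.1 hlt) ?_
      simpa using t.2.2⟩
  have hg : Function.Injective g := by
    intro t t' htt
    have h0 : (g t).1 = (g t').1 := congrArg Subtype.val htt
    have h1 := (e.f s).symm.injective (Subtype.ext h0)
    exact Subtype.ext (congrArg (fun x : M.liveSuccs s => x.1) h1)
  have h1 := Cardinal.lift_mk_le_lift_mk_of_injective hg
  rw [Cardinal.mk_Iio_ordinal, Cardinal.lift_lift, Cardinal.lift_umax.{u, u + 1},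
    Cardinal.lift_le] at h1
  exact absurd ((h.trans h1).trans_lt (Cardinal.lt_ord.1 hδ)) (lt_irrefl _)

/-- Fewer than `c` places are bounded below `c.ord`, by regularity. -/
theorem exists_lt_of_count_lt {p : M.World → Prop} {c : Cardinal.{u}} (hc : c.IsRegular)
    (h : M.count s p < c) (hlive : #(M.liveSuccs s) ≤ c) :
    ∃ δ < c.ord, ∀ γ : Set.Iio (#(M.liveSuccs s)).ord, δ ≤ γ.1 → ¬ p (e.f s γ) := by
  let I := {t : M.liveSuccs s // p t.1}
  have hI : #I < c.ord.cof := by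
    rw [hc.cof_ord]
    refine lt_of_le_of_lt ?_ h
    let g : I → {t : M.World // M.R s t ∧ p t} := fun t => ⟨t.1.1, t.1.2.1, t.2⟩
    refine Cardinal.mk_le_of_injective (f := g) fun t t' h => ?_
    have h0 : (g t).1 = (g t').1 := congrArg Subtype.val h
    exact Subtype.ext (Subtype.ext h0)
  refine ⟨⨆ t : I, (((e.f s).symm t.1).1 + 1), Ordinal.iSup_add_one_lt_of_lt_cof hI fun t =>
    ((e.f s).symm t.1).2.trans_le (Cardinal.ord_le_ord.2 hlive), fun γ hγ hp => ?_⟩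
  have := (Ordinal.le_iSup (fun t : I => (((e.f s).symm t.1).1 + 1)) ⟨e.f s γ, hp⟩).trans hγ
  simp at this

theorem type_succLT_card (t : M.World) (Q : M.World → Prop) :
    (Ordinal.type (e.succLT t Q)).card = M.count t Q := by
  rw [Ordinal.card_type, count_eq_mk_succs]

theorem type_succLT_le (t : M.World) (Q : M.World → Prop) :
    Ordinal.type (e.succLT t Q) ≤ (#(M.succs t)).ord := by
  have h := Ordinal.lift_type_le.{u, u + 1, u + 1}.2
    ⟨(⟨⟨fun x : {x : M.succs t // Q x} => (e.g t).symm x.1,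
      (e.g t).symm.injective.comp Subtype.val_injective⟩, Iff.rfl⟩ :
        e.succLT t Q ↪r (· < · : Set.Iio (#(M.succs t)).ord → _ → Prop)).collapse⟩
  rw [Ordinal.type_lt_Iio, Ordinal.lift_lift] at h
  exact Ordinal.lift_le.1 h

/-- The class of an ordinal sum over the live successors of `s` which counts, up to a choice of
order types, the grandsuccessors that satisfy `Q`. -/
theorem classMin_level {ζ : Ordinal.{u}} (hu : ∀ x y z, M.R x z → M.R y z → x = y)
    (hG : #(M.grandSuccs s) = ℵ_ ζ) (hreg : (ℵ_ ζ).IsRegular) (Q : M.World → Prop)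
    (F : Set.Iio (#(M.liveSuccs s)).ord → Ordinal.{u})
    (hF : ∀ γ, (F γ).card = M.count (e.f s γ) Q) (hF' : ∀ γ, F γ ≤ ω_ ζ) :
    classMin ζ (M.level s Q) ≤ ordSum F ∧ ordSum F < classMin ζ (M.level s Q + 1) := by
  have hlive : #(M.liveSuccs s) ≤ ℵ_ ζ := hG ▸ mk_liveSuccs_le_mk_grandSuccs hu s
  have hΛ : (#(M.liveSuccs s)).ord ≤ (ℵ_ ζ).ord := Cardinal.ord_le_ord.2 hlive
  have hlt : ∀ γ, F γ < ω_ ζ ↔ M.count (e.f s γ) Q < ℵ_ ζ := fun γ => by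
    rw [← hF, ← ord_aleph, Cardinal.lt_ord]
  have hge : ∀ γ, ω_ ζ ≤ F γ ↔ ℵ_ ζ ≤ M.count (e.f s γ) Q := fun γ => by
    rw [← not_lt, hlt, not_lt]
  have hz : ∀ γ, F γ = 0 ↔ M.count (e.f s γ) Q = 0 := fun γ => by
    rw [← hF, Ordinal.card_eq_zero]
  rw [← ord_aleph] at hF' hlt hge
  set f : Ordinal.{u} → Ordinal.{u} :=
    fun γ => if h : γ < (#(M.liveSuccs s)).ord then F ⟨γ, h⟩ else 0 with hf
  have hfF : ∀ γ : Set.Iio (#(M.liveSuccs s)).ord, f γ.1 = F γ := fun γ => dif_pos γ.2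
  have hfl : ∀ γ < (#(M.liveSuccs s)).ord, f γ ≤ (ℵ_ ζ).ord := fun γ h => by
    rw [hfF ⟨γ, h⟩]; exact hF' _
  change classMin ζ (M.level s Q) ≤ partialSum f _ ∧ partialSum f _ < classMin ζ (M.level s Q + 1)
  have hsome : ∀ γ : Set.Iio (#(M.liveSuccs s)).ord,
      (∃ x, M.R (e.f s γ) x ∧ Q x) ↔ F γ ≠ 0 := fun γ => by
    rw [Ne, hz, ← Ne, count_ne_zero]
  have hζ0 : ℵ_ ζ ≠ 0 := hreg.ne_zero
  have live_of_le : ∀ t, ℵ_ ζ ≤ M.count t Q → ∃ x, M.R t x := fun t h => by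
    obtain ⟨x, hx, -⟩ := count_ne_zero.1 (fun h0 => hζ0 (nonpos_iff_eq_zero.1 (h0 ▸ h)))
    exact ⟨x, hx⟩
  have lift_world : ∀ t, M.R s t → (∃ x, M.R t x) →
      ∃ γ : Set.Iio (#(M.liveSuccs s)).ord, (e.f s γ).1 = t := fun t h h' =>
    ⟨(e.f s).symm ⟨t, h, h'⟩, by simp⟩
  have hpos : 0 < ω_ ζ := omega_pos ζ
  unfold level
  rw [hG]
  split_ifs with h3 h2 h1
  -- Level 3: the value `ω_ ζ` occurs cofinally in `ω_ ζ`, so the sum is at least `ω_ ζ ^ 2`; it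
  -- never exceeds `ω_ ζ * ω_ ζ`.
  · simp only [classMin]
    constructor
    · rw [sq]
      have := mul_ord_le_partialSum (f := f) (a := ω_ ζ) hreg hΛ fun δ hδ => by
        obtain ⟨γ, hγ, hp⟩ := e.exists_le_of_le_count (p := fun t => ℵ_ ζ ≤ M.count t Q)
          live_of_le h3 hδ
        refine ⟨γ.1, γ.2, hγ, ?_⟩
        rw [hfF, ← ord_aleph]
        exact (hge γ).2 hp
      rwa [ord_aleph] at this
    · refine (partialSum_le_mul hfl).trans_lt ?_
      rw [pow_succ, sq, ord_aleph]
      calc ω_ ζ * (#(M.liveSuccs s)).ord ≤ ω_ ζ * ω_ ζ := by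
            gcongr
            rwa [ord_aleph] at hΛ
        _ = ω_ ζ * ω_ ζ * 1 := (mul_one _).symm
        _ < ω_ ζ * ω_ ζ * ω_ ζ :=
          (mul_lt_mul_iff_right₀ (mul_pos hpos hpos)).2
            (one_lt_omega0.trans_le (omega0_le_omega ζ))
  -- Level 2: one value `ω_ ζ`, or cofinally many nonzero values, give at least `ω_ ζ`. The values
  -- `ω_ ζ` occur only before some `δ < ω_ ζ`, which keeps the sum below `ω_ ζ ^ 2`.
  · simp only [classMin, pow_one]
    constructor
    · rcases h2 with ⟨t, ht, hq⟩ | hq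
      · obtain ⟨γ, rfl⟩ := lift_world t ht (live_of_le t hq)
        refine le_trans ?_ (le_partialSum γ.2)
        rw [hfF, ← ord_aleph]
        exact (hge γ).2 hq
      · have := mul_ord_le_partialSum (f := f) (a := 1) hreg hΛ fun δ hδ => by
          obtain ⟨γ, hγ, hp⟩ := e.exists_le_of_le_count (p := fun t => ∃ x, M.R t x ∧ Q x)
            (fun t ⟨x, hx, _⟩ => ⟨x, hx⟩) hq hδ
          refine ⟨γ.1, γ.2, hγ, ?_⟩
          rw [hfF]
          exact Order.one_le_iff_pos.2 (pos_iff_ne_zero.2 ((hsome γ).1 hp))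
        rwa [one_mul, ord_aleph] at this
    · obtain ⟨δ, hδ, hlast⟩ := e.exists_lt_of_count_lt hreg (not_le.1 h3) hlive
      have := partialSum_lt_ord_mul_ord (f := f) hreg hΛ hδ (fun γ hγ hγΛ => by
        rw [hfF ⟨γ, hγΛ⟩]
        exact (hlt _).2 (not_le.1 (hlast ⟨γ, hγΛ⟩ hγ))) hfl
      rwa [ord_aleph, ← sq] at this
  -- Level 1: all values are below `ω_ ζ`, and the nonzero ones occur before some `δ < ω_ ζ`.
  · simp only [classMin, pow_one, pow_zero]
    push Not at h2
    constructor
    · obtain ⟨t, ht, x, hx, hq⟩ := h1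
      obtain ⟨γ, rfl⟩ := lift_world t ht ⟨x, hx⟩
      refine le_trans ?_ (le_partialSum γ.2)
      rw [hfF]
      exact Order.one_le_iff_pos.2 (pos_iff_ne_zero.2 ((hsome γ).1 ⟨x, hx, hq⟩))
    · obtain ⟨δ, hδ, hlast⟩ := e.exists_lt_of_count_lt hreg h2.2 hlive
      have := partialSum_lt_ord (f := f) hreg hδ (fun γ hγ hγΛ => by
        rw [hfF ⟨γ, hγΛ⟩]
        by_contra h0
        exact hlast ⟨γ, hγΛ⟩ hγ ((hsome _).2 h0)) (fun γ hγΛ => by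
        rw [hfF ⟨γ, hγΛ⟩]
        exact (hlt _).2 (h2.1 _ (e.f s ⟨γ, hγΛ⟩).2.1))
      rwa [ord_aleph] at this
  · simp only [classMin, pow_zero]
    refine ⟨zero_le, Order.lt_one_iff.2 ?_⟩
    refine nonpos_iff_eq_zero.1 ((partialSum_le_of_forall_eq_zero (δ := 0) fun γ _ hγ => ?_).trans
      (partialSum_zero f).le)
    rw [hfF ⟨γ, hγ⟩]
    by_contra h0
    exact h1 ⟨_, (e.f s ⟨γ, hγ⟩).2.1, (hsome _).2 h0⟩

theorem ordSum_h_card_lt_aleph0 (h : #(M.grandSuccs s) < ℵ₀)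
    (hu : ∀ x y z, M.R x z → M.R y z → x = y) : (ordSum (e.h s)).card < ℵ₀ := by
  obtain ⟨h1, h2⟩ := (mk_grandSuccs_lt_aleph0_iff hu s).1 h
  rw [← Cardinal.lt_ord]
  refine partialSum_lt_ord isRegular_aleph0 (Cardinal.ord_lt_ord.2 h1)
    (fun γ hγ hγ' => absurd hγ (not_le.2 hγ')) fun γ hγ => ?_
  simp only [hγ, dif_pos]
  exact Cardinal.ord_lt_ord.2 (h2 _ (e.f s ⟨γ, hγ⟩).2.1)

/-- For the property `True` the level is 2 or 3, so the sum lies between `ω_ ζ` and `ω_ ζ ^ 3`. Thus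
the index in the semantics of `boxbox` is that of the number of grandsuccessors. -/
theorem ordSum_h_card {ζ : Ordinal.{u}} (hu : ∀ x y z, M.R x z → M.R y z → x = y)
    (hG : #(M.grandSuccs s) = ℵ_ ζ) (hreg : (ℵ_ ζ).IsRegular) :
    (ordSum (e.h s)).card = ℵ_ ζ := by
  obtain ⟨h1, h2⟩ := e.classMin_level hu hG hreg (fun _ => True) (e.h s)
    (fun γ => by rw [count_true]; simp [h])
    (fun γ => by
      rw [← ord_aleph, ← hG]
      exact Cardinal.ord_le_ord.2 (mk_succs_le_mk_grandSuccs (e.f s γ).2.1))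
  have hl2 : 2 ≤ M.level s fun _ => True := by
    have : (∃ t, M.R s t ∧ #(M.grandSuccs s) ≤ M.count t fun _ => True) ∨
        #(M.grandSuccs s) ≤ M.count s (fun t => ∃ x, M.R t x ∧ True) := by
      simp only [count_true, and_true]
      exact exists_le_mk_succs_or_le_mk_liveSuccs (hG ▸ hreg)
    unfold level
    rw [if_pos this]
    split_ifs <;> norm_num
  have hl3 : (M.level s fun _ => True) ≤ 3 := by
    unfold level
    split_ifs <;> norm_num
  have h1' : ω_ ζ ≤ ordSum (e.h s) := by
    simpa [classMin] using (classMin_mono ζ hl2).trans h1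
  have h2' : ordSum (e.h s) < ω_ ζ ^ 3 :=
    h2.trans_le (classMin_mono ζ (Nat.succ_le_succ hl3))
  apply le_antisymm
  · refine (Ordinal.card_le_card h2'.le).trans ?_
    have := aleph0_le_aleph ζ
    simp [pow_succ, Ordinal.card_mul, Cardinal.mul_eq_self this]
  · simpa using Ordinal.card_le_card h1'

end Enumeration

theorem sat_iff_holds (hu : ∀ x y z, M.R x z → M.R y z → x = y) (hreg : M.HasRegularCards)
    (e : M.Enumeration) (φ : Formula P) : ∀ s, M.Sat e φ s ↔ M.Holds φ s := by
  induction φ with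
  | atom p => exact fun s => Iff.rfl
  | neg φ ih => exact fun s => not_congr (ih s)
  | and φ ψ ih ih' => exact fun s => and_congr (ih s) (ih' s)
  | box φ ih =>
    intro s
    have : M.Sat e φ = M.Holds φ := funext fun t => propext (ih t)
    simp only [Sat, Holds, this, count]
  | boxbox φ ih =>
    intro s
    have : M.Sat e φ = M.Holds φ := funext fun t => propext (ih t)
    simp only [Sat, Holds, this]
    rcases lt_or_ge #(M.grandSuccs s) ℵ₀ with hfin | hinf
    · have hS := e.ordSum_h_card_lt_aleph0 hfin hu
      simp only [hfin, hS, true_and, not_le.2 hfin, false_and, false_or]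
      refine or_iff_right ?_
      rintro ⟨ζ, hζ, -⟩
      rw [hζ] at hS
      exact absurd hS (not_lt.2 (aleph0_le_aleph ζ))
    · obtain ⟨ζ, hζ⟩ := mem_range_aleph_iff.2 hinf
      have hr := hreg s hinf
      rw [← hζ] at hr
      have hS := e.ordSum_h_card hu hζ.symm hr
      have key : ∀ Q, classMin ζ (M.level s Q) ≤ ordSum (e.hOf s Q) ∧
          ordSum (e.hOf s Q) < classMin ζ (M.level s Q + 1) := fun Q =>
        e.classMin_level hu hζ.symm hr Q (e.hOf s Q) (fun γ => e.type_succLT_card _ Q)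
          (fun γ => (e.type_succLT_le _ Q).trans (by
            rw [← ord_aleph, hζ]
            exact Cardinal.ord_le_ord.2 (mk_succs_le_mk_grandSuccs (e.f s γ).2.1)))
      have hcl : ∀ Q Q', ClassLT ζ (ordSum (e.hOf s Q)) (ordSum (e.hOf s Q')) ↔
          M.level s Q < M.level s Q' := fun Q Q' =>
        classLT_iff (key Q).1 (key Q).2 (key Q').1 (key Q').2
      rw [hS]
      simp only [hinf, true_and, not_lt.2 hinf, false_and, or_false,
        not_lt.2 (aleph0_le_aleph ζ)]
      constructor
      · rintro ⟨ζ', h1, h2⟩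
        obtain rfl : ζ = ζ' := aleph.injective h1
        exact (hcl _ _).1 h2
      · exact fun h => ⟨ζ, rfl, (hcl _ _).2 h⟩

end KripkeModel

/-! ### Collapsing finitely many cardinals below `ℵ_ ω` -/

open Classical in
/-- Finite cardinals are kept, and an infinite cardinal is sent to `ℵ_ (m + i)` if exactly `i`
members of `A` are below it. -/
noncomputable def collapse (A : Finset Cardinal.{u}) (m : ℕ) (c : Cardinal.{u}) : Cardinal.{u} :=
  if c < ℵ₀ then c else ℵ_ ((m + (A.filter (· < c)).card : ℕ) : Ordinal.{u})

section Collapse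

variable {A : Finset Cardinal.{u}} {m : ℕ} {c d : Cardinal.{u}}

theorem collapse_of_lt (h : c < ℵ₀) : collapse A m c = c := if_pos h

theorem collapse_zero : collapse A m 0 = 0 := collapse_of_lt aleph0_pos

theorem collapse_lt_aleph0 : collapse A m c < ℵ₀ ↔ c < ℵ₀ := by
  unfold collapse
  split_ifs with h
  · rfl
  · exact iff_of_false (not_lt.2 (aleph0_le_aleph _)) h

theorem collapse_mono : Monotone (collapse A m) := by
  intro c d h
  rcases lt_or_ge d ℵ₀ with hd | hd
  · rwa [collapse_of_lt hd, collapse_of_lt (h.trans_lt hd)]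
  rcases lt_or_ge c ℵ₀ with hc | hc
  · exact (collapse_lt_aleph0.2 hc).le.trans
      (not_lt.1 fun h' => not_lt.2 hd (collapse_lt_aleph0.1 h'))
  rw [collapse, collapse, if_neg (not_lt.2 hc), if_neg (not_lt.2 hd), aleph_le_aleph,
    Nat.cast_le]
  gcongr

/-- If `c < d` are infinite, then `c` itself is a member of `A` counted for `d` but not for `c`.
Hence only the smaller cardinal has to lie in `A`. -/
theorem collapse_le_iff (hc : c ∈ A) : collapse A m d ≤ collapse A m c ↔ d ≤ c := by
  refine ⟨fun h => ?_, fun h => collapse_mono h⟩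
  by_contra! hcd
  refine absurd h (not_le.2 ?_)
  rcases lt_or_ge c ℵ₀ with hc0 | hc0
  · rcases lt_or_ge d ℵ₀ with hd | hd
    · rwa [collapse_of_lt hd, collapse_of_lt hc0]
    · exact (collapse_lt_aleph0.2 hc0).trans_le
        (not_lt.1 fun h' => not_lt.2 hd (collapse_lt_aleph0.1 h'))
  · rw [collapse, collapse, if_neg (not_lt.2 hc0), if_neg (not_lt.2 (hc0.trans hcd.le)),
      aleph_lt_aleph, Nat.cast_lt]
    refine Nat.add_lt_add_left (Finset.card_lt_card ?_) m
    refine Finset.ssubset_iff_of_subset (fun x hx => ?_) |>.2 ⟨c, ?_, ?_⟩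
    · rw [Finset.mem_filter] at hx ⊢
      exact ⟨hx.1, hx.2.trans hcd⟩
    · exact Finset.mem_filter.2 ⟨hc, hcd⟩
    · simp

theorem collapse_lt_iff (hc : c ∈ A) : collapse A m c < collapse A m d ↔ c < d := by
  rw [← not_le, collapse_le_iff hc, not_le]

theorem collapse_eq_zero : collapse A m c = 0 ↔ c = 0 := by
  refine ⟨fun h => ?_, fun h => by rw [h, collapse_zero]⟩
  have : c < ℵ₀ := collapse_lt_aleph0.1 (h ▸ aleph0_pos)
  rwa [collapse_of_lt this] at h

theorem collapse_add : collapse A m (c + d) = collapse A m c + collapse A m d := by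
  rcases lt_or_ge (c + d) ℵ₀ with h | h
  · rw [collapse_of_lt h, collapse_of_lt (le_self_add.trans_lt h),
      collapse_of_lt (le_add_self.trans_lt h)]
  · have h' : ℵ₀ ≤ max c d := by
      by_contra! h'
      rw [max_lt_iff] at h'
      exact absurd (Cardinal.add_lt_aleph0 h'.1 h'.2) (not_lt.2 h)
    have hc : ℵ₀ ≤ max (collapse A m c) (collapse A m d) := by
      rw [← collapse_mono.map_max]
      exact not_lt.1 fun h1 => not_lt.2 h' (collapse_lt_aleph0.1 h1)
    have e1 : c + d = max c d := by
      rcases le_max_iff.1 h' with h1 | h1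
      · exact Cardinal.add_eq_max h1
      · exact Cardinal.add_eq_max' h1
    have e2 : collapse A m c + collapse A m d = max (collapse A m c) (collapse A m d) := by
      rcases le_max_iff.1 hc with h1 | h1
      · exact Cardinal.add_eq_max h1
      · exact Cardinal.add_eq_max' h1
    rw [e1, e2, collapse_mono.map_max]

theorem collapse_preimage {J J' T : Type u} [Finite T] {g : J → T} {g' : J' → T}
    (h : ∀ τ, #(g' ⁻¹' {τ}) = collapse A m #(g ⁻¹' {τ})) (B : Set T) :
    #(g' ⁻¹' B) = collapse A m #(g ⁻¹' B) := by
  induction B, B.toFinite using Set.Finite.induction_on with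
  | empty => simp [collapse_zero]
  | @insert a B ha hB ih =>
    have hd : ∀ {J : Type u} (g : J → T), #(g ⁻¹' insert a B) = #(g ⁻¹' {a}) + #(g ⁻¹' B) := by
      intro J g
      rw [Set.insert_eq, Set.preimage_union, Cardinal.mk_union_of_disjoint]
      exact Disjoint.preimage _ (Set.disjoint_singleton_left.2 ha)
    rw [hd, hd, collapse_add, h, ih]

end Collapse

namespace KripkeModel

variable {P : Type v}

/-! ### Finitely many types -/

theorem finite_setOf_holds [Finite P] (M : KripkeModel.{u, v} P) (k : ℕ) :
    {Q : M.World → Prop | ∃ φ : Formula P, φ.deg < k ∧ Q = M.Holds φ}.Finite := by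
  induction k with
  | zero => simp
  | succ k ih =>
    let boxOp : (M.World → Prop) → M.World → Prop := fun Q s =>
      (ℵ₀ ≤ #(M.succs s) ∧ M.count s (fun t => ¬ Q t) < M.count s Q) ∨
      (#(M.succs s) < ℵ₀ ∧ ∀ t, M.R s t → Q t)
    let boxboxOp : (M.World → Prop) → M.World → Prop := fun Q s =>
      (ℵ₀ ≤ #(M.grandSuccs s) ∧ M.level s (fun x => ¬ Q x) < M.level s Q) ∨
      (#(M.grandSuccs s) < ℵ₀ ∧ ∀ t x, M.R s t → M.R t x → Q x)
    set F := {Q : M.World → Prop | ∃ φ : Formula P, φ.deg < k ∧ Q = M.Holds φ}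
    let G : Set (M.World → Prop) :=
      (Set.range fun p x => x ∈ M.V p) ∪ (boxOp '' F ∪ boxboxOp '' F)
    have hG : G.Finite := (Set.finite_range _).union ((ih.image _).union (ih.image _))
    have := hG.to_subtype
    -- A Boolean combination of the finitely many generators in `G` is given by the set `B` of
    -- admissible truth patterns.
    let ext : Set (Set G) → M.World → Prop := fun B x => {q : G | q.1 x} ∈ B
    have hmem : ∀ Q ∈ G, Q ∈ Set.range ext := fun Q hQ =>
      ⟨{C | (⟨Q, hQ⟩ : G) ∈ C}, rfl⟩
    refine (Set.finite_range ext).subset ?_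
    rintro _ ⟨φ, hφ, rfl⟩
    induction φ with
    | atom p => exact hmem _ (Or.inl ⟨p, rfl⟩)
    | neg φ ih' =>
      obtain ⟨B, hB⟩ := ih' hφ
      exact ⟨Bᶜ, funext fun x => congrArg Not (congrFun hB x)⟩
    | and φ ψ ih1 ih2 =>
      obtain ⟨B, hB⟩ := ih1 ((le_max_left _ _).trans_lt hφ)
      obtain ⟨C, hC⟩ := ih2 ((le_max_right _ _).trans_lt hφ)
      exact ⟨B ∩ C, funext fun x => congrArg₂ And (congrFun hB x) (congrFun hC x)⟩
    | box φ _ =>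
      refine hmem _ (Or.inr (Or.inl ⟨M.Holds φ, ⟨φ, ?_, rfl⟩, rfl⟩))
      simp only [Formula.deg] at hφ; omega
    | boxbox φ _ =>
      refine hmem _ (Or.inr (Or.inr ⟨M.Holds φ, ⟨φ, ?_, rfl⟩, rfl⟩))
      simp only [Formula.deg] at hφ; omega

/-- `M, s` and `N, w` agree on formulas of degree at most `k`, and for formulas of degree less
than `k` the numbers of successors satisfying them agree as to being zero, being finite and
reaching `ℵ_ α` and `ℵ_ β` respectively. -/
structure Agree (k : ℕ) (α β : Ordinal.{u}) (M : KripkeModel.{u, v} P) (s : M.World)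
    (N : KripkeModel.{u, v} P) (w : N.World) : Prop where
  holds : ∀ φ : Formula P, φ.deg ≤ k → (M.Holds φ s ↔ N.Holds φ w)
  zero : ∀ φ : Formula P, φ.deg < k →
    (M.count s (M.Holds φ) = 0 ↔ N.count w (N.Holds φ) = 0)
  finite : ∀ φ : Formula P, φ.deg < k →
    (M.count s (M.Holds φ) < ℵ₀ ↔ N.count w (N.Holds φ) < ℵ₀)
  top : ∀ φ : Formula P, φ.deg < k →
    (ℵ_ α ≤ M.count s (M.Holds φ) ↔ ℵ_ β ≤ N.count w (N.Holds φ))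

theorem Agree.trans {k : ℕ} {α β γ : Ordinal.{u}} {M : KripkeModel.{u, v} P} {s : M.World}
    {N : KripkeModel.{u, v} P} {w : N.World} {K : KripkeModel.{u, v} P} {x : K.World}
    (h : Agree k α β M s N w) (h' : Agree k β γ N w K x) : Agree k α γ M s K x :=
  ⟨fun φ hφ => (h.holds φ hφ).trans (h'.holds φ hφ),
    fun φ hφ => (h.zero φ hφ).trans (h'.zero φ hφ),
    fun φ hφ => (h.finite φ hφ).trans (h'.finite φ hφ),
    fun φ hφ => (h.top φ hφ).trans (h'.top φ hφ)⟩

theorem exists_finite_types [Finite P] (M : KripkeModel.{u, v} P) (k : ℕ) (α : Ordinal.{u}) :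
    ∃ (T : Type u) (_ : Finite T) (tp : M.World → T),
      ∀ t t', tp t = tp t' → Agree k α α M t M t' := by
  let F := {Q : M.World → Prop | ∃ φ : Formula P, φ.deg < k + 1 ∧ Q = M.Holds φ}
  have : Finite F := (M.finite_setOf_holds (k + 1)).to_subtype
  refine ⟨Set F × Set F × Set F × Set F, inferInstance, fun t =>
    ({Q | Q.1 t}, {Q | M.count t Q.1 = 0}, {Q | M.count t Q.1 < ℵ₀}, {Q | ℵ_ α ≤ M.count t Q.1}),
    fun t t' h => ?_⟩
  simp only [Prod.mk.injEq] at h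
  obtain ⟨h1, h2, h3, h4⟩ := h
  have mem : ∀ φ : Formula P, φ.deg < k + 1 → M.Holds φ ∈ F := fun φ hφ => ⟨φ, hφ, rfl⟩
  exact ⟨fun φ hφ => Set.ext_iff.1 h1 ⟨_, mem φ (by omega)⟩,
    fun φ hφ => Set.ext_iff.1 h2 ⟨_, mem φ (by omega)⟩,
    fun φ hφ => Set.ext_iff.1 h3 ⟨_, mem φ (by omega)⟩,
    fun φ hφ => Set.ext_iff.1 h4 ⟨_, mem φ (by omega)⟩⟩

/-! ### Agreement at a world from agreement at its successors -/

section Step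

variable {M N : KripkeModel.{u, v} P} {s : M.World} {w : N.World}

/-- A correspondence between the successors of `s` and those of `w` under which numbers of
successors are collapsed. -/
structure Matching (A : Finset Cardinal.{u}) (m : ℕ) (M : KripkeModel.{u, v} P) (s : M.World)
    (N : KripkeModel.{u, v} P) (w : N.World) (E : M.World → N.World → Prop) : Prop where
  cover : ∀ x, N.R w x → ∃ t, M.R s t ∧ E t x
  count_eq : ∀ (Q : M.World → Prop) (Q' : N.World → Prop),
    (∀ t x, M.R s t → N.R w x → E t x → (Q t ↔ Q' x)) →
    N.count w Q' = collapse A m (M.count s Q) ∧ M.count s Q ∈ A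

variable {A : Finset Cardinal.{u}} {m : ℕ} {E : M.World → N.World → Prop}

theorem Matching.mk_succs (h : Matching A m M s N w E) :
    #(N.succs w) = collapse A m #(M.succs s) := by
  rw [← count_true, ← count_true]
  exact (h.count_eq _ _ fun _ _ _ _ _ => Iff.rfl).1

theorem Matching.exists_iff (h : Matching A m M s N w E) {Q : M.World → Prop}
    {Q' : N.World → Prop} (hQ : ∀ t x, M.R s t → N.R w x → E t x → (Q t ↔ Q' x)) :
    (∃ t, M.R s t ∧ Q t) ↔ ∃ x, N.R w x ∧ Q' x := by
  rw [← count_ne_zero, ← count_ne_zero, (h.count_eq Q Q' hQ).1, Ne, Ne, collapse_eq_zero]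

theorem Matching.le_count_iff (h : Matching A m M s N w E) {Q : M.World → Prop}
    {Q' : N.World → Prop} (hQ : ∀ t x, M.R s t → N.R w x → E t x → (Q t ↔ Q' x))
    {c d : Cardinal.{u}} (hc : collapse A m c = d) : c ≤ M.count s Q ↔ d ≤ N.count w Q' := by
  obtain ⟨h1, h2⟩ := h.count_eq Q Q' hQ
  rw [h1, ← hc, collapse_le_iff h2]

variable {k : ℕ} {ζ ζ' : Ordinal.{u}}

/-- The comparison survives collapsing because the number of successors refuting `φ` belongs to `A`.
Finite worlds only ask whether that number is zero. -/
theorem Matching.holds_box (h : Matching A m M s N w E) {φ : Formula P}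
    (hφ : ∀ t x, M.R s t → N.R w x → E t x → (M.Holds φ t ↔ N.Holds φ x)) :
    M.Holds (.box φ) s ↔ N.Holds (.box φ) w := by
  have hall : ∀ {K : KripkeModel.{u, v} P} (r : K.World), (∀ t, K.R r t → K.Holds φ t) ↔
      K.count r (fun t => ¬ K.Holds φ t) = 0 := fun r => by simp [count_eq_zero]
  obtain ⟨h1, -⟩ := h.count_eq _ _ hφ
  obtain ⟨h2, h2'⟩ := h.count_eq (fun t => ¬ M.Holds φ t) (fun t => ¬ N.Holds φ t)
    fun t x ht hx hE => not_congr (hφ t x ht hx hE)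
  simp only [Holds, hall, ← not_lt (a := #_) (b := ℵ₀)]
  rw [h.mk_succs, h1, h2, collapse_lt_aleph0, collapse_lt_iff h2', collapse_eq_zero]

/-- A formula that holds everywhere. -/
theorem exists_holds_deg_zero [Nonempty P] :
    ∃ φ : Formula P, φ.deg = 0 ∧ ∀ K : KripkeModel.{u, v} P, K.Holds φ = fun _ => True := by
  obtain ⟨p⟩ := ‹Nonempty P›
  refine ⟨.neg (.and (.atom p) (.neg (.atom p))), rfl, fun K => funext fun x => ?_⟩
  simp [Holds]

theorem Agree.live_iff [Nonempty P] (hk : 0 < k) {t : M.World} {x : N.World}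
    (h : Agree k ζ ζ' M t N x) : (∃ y, M.R t y) ↔ ∃ y, N.R x y := by
  obtain ⟨φ, hφ, hT⟩ := exists_holds_deg_zero.{u, v} (P := P)
  have := not_congr (h.zero φ (by omega))
  rw [← Ne, ← Ne, count_ne_zero, count_ne_zero] at this
  simpa [hT] using this

theorem Matching.mk_liveSuccs [Nonempty P] (hk : 0 < k) (h : Matching A m M s N w E)
    (hE : ∀ t x, M.R s t → N.R w x → E t x → Agree k ζ ζ' M t N x) :
    #(N.liveSuccs w) = collapse A m #(M.liveSuccs s) ∧ #(M.liveSuccs s) ∈ A :=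
  h.count_eq (fun t => ∃ y, M.R t y) (fun x => ∃ y, N.R x y)
    fun _ _ ht hx htx => (hE _ _ ht hx htx).live_iff hk

/-- In a tree, having finitely many grandsuccessors means having finitely many live successors, each
with finitely many successors. The field `finite` of `Agree`, applied to a tautology, transfers the
latter. -/
theorem Matching.mk_grandSuccs_lt [Nonempty P] (hk : 0 < k) (h : Matching A m M s N w E)
    (hE : ∀ t x, M.R s t → N.R w x → E t x → Agree k ζ ζ' M t N x)
    (huM : ∀ x y z, M.R x z → M.R y z → x = y)
    (huN : ∀ x y z, N.R x z → N.R y z → x = y) :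
    #(M.grandSuccs s) < ℵ₀ ↔ #(N.grandSuccs w) < ℵ₀ := by
  obtain ⟨φ, hφ, hT⟩ := exists_holds_deg_zero.{u, v} (P := P)
  rw [mk_grandSuccs_lt_aleph0_iff huM, mk_grandSuccs_lt_aleph0_iff huN,
    (h.mk_liveSuccs hk hE).1, collapse_lt_aleph0]
  refine and_congr Iff.rfl ?_
  have := not_congr (h.exists_iff (Q := fun t => ¬ #(M.succs t) < ℵ₀)
    (Q' := fun x => ¬ #(N.succs x) < ℵ₀) fun t x ht hx htx => by
      have := (hE t x ht hx htx).finite φ (by omega)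
      rw [hT, hT, count_true, count_true] at this
      exact not_congr this)
  push Not at this
  exact this

/-- By regularity, either some successor of `s` already has `ℵ_ ζ` successors, which `top`
transfers, or `s` has `ℵ_ ζ` live successors, which `collapse` transfers. -/
theorem Matching.mk_grandSuccs_eq [Nonempty P] (hk : 0 < k) (h : Matching A m M s N w E)
    (hE : ∀ t x, M.R s t → N.R w x → E t x → Agree k ζ ζ' M t N x)
    (huM : ∀ x y z, M.R x z → M.R y z → x = y)
    (huN : ∀ x y z, N.R x z → N.R y z → x = y)
    (hle : ∀ x, N.R w x → #(N.succs x) ≤ ℵ_ ζ') (hζ : collapse A m (ℵ_ ζ) = ℵ_ ζ')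
    (hG : #(M.grandSuccs s) = ℵ_ ζ) (hreg : (ℵ_ ζ).IsRegular) :
    #(N.grandSuccs w) = ℵ_ ζ' := by
  obtain ⟨φ, hφ, hT⟩ := exists_holds_deg_zero.{u, v} (P := P)
  obtain ⟨hl, hl'⟩ := h.mk_liveSuccs hk hE
  apply le_antisymm
  · refine (mk_grandSuccs_le_mul hle).trans (Cardinal.mul_le_of_le (aleph0_le_aleph _) ?_ le_rfl)
    rw [hl, ← hζ]
    exact collapse_mono (hG ▸ mk_liveSuccs_le_mk_grandSuccs huM s)
  · rcases exists_le_mk_succs_or_le_mk_liveSuccs (hG ▸ hreg) with ht | hs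
    · rw [hG, h.exists_iff (Q' := fun x => ℵ_ ζ' ≤ #(N.succs x)) fun t x ht hx htx => by
        have := (hE t x ht hx htx).top φ (by omega)
        rwa [hT, hT, count_true, count_true] at this] at ht
      obtain ⟨x, hx, hle'⟩ := ht
      exact hle'.trans (mk_succs_le_mk_grandSuccs hx)
    · rw [hG, ← collapse_le_iff (m := m) hl', hζ, ← hl] at hs
      exact hs.trans (mk_liveSuccs_le_mk_grandSuccs huN w)

theorem ite_congr_of_iff {p q : Prop} {_ : Decidable p} {_ : Decidable q} (h : p ↔ q)
    {i j j' : ℕ} (hj : j = j') : (if p then i else j) = if q then i else j' :=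
  if_congr h rfl hj

/-- Every question in `level` asks whether some, or at least `ℵ_ ζ`, successors have a property that
`zero` or `top` transfers. The matching handles such properties although they need not be definable
by formulas. -/
theorem Matching.level_eq (h : Matching A m M s N w E)
    (hE : ∀ t x, M.R s t → N.R w x → E t x → Agree k ζ ζ' M t N x)
    (hζ : collapse A m (ℵ_ ζ) = ℵ_ ζ')
    (hG : #(M.grandSuccs s) = ℵ_ ζ) (hG' : #(N.grandSuccs w) = ℵ_ ζ')
    {φ : Formula P} (hφ : φ.deg < k) :
    M.level s (M.Holds φ) = N.level w (N.Holds φ) := by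
  have hsome : ∀ t x, M.R s t → N.R w x → E t x →
      ((∃ y, M.R t y ∧ M.Holds φ y) ↔ ∃ y, N.R x y ∧ N.Holds φ y) := fun t x ht hx htx => by
    rw [← count_ne_zero, ← count_ne_zero]
    exact not_congr ((hE t x ht hx htx).zero φ hφ)
  have htop := fun t x ht hx htx => (hE t x ht hx htx).top φ hφ
  unfold level
  rw [hG, hG']
  exact ite_congr_of_iff (h.le_count_iff htop hζ)
    (ite_congr_of_iff (or_congr (h.exists_iff htop) (h.le_count_iff hsome hζ))
      (ite_congr_of_iff (h.exists_iff hsome) rfl))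

/-- Two pairs of thresholds occur: `ζ, ζ'` for the successor counts of the successors, hence for
`boxbox` at the root, and `α, β` for the successor counts of the root itself. -/
theorem Matching.agree [Nonempty P] (h : Matching A m M s N w E)
    (hE : ∀ t x, M.R s t → N.R w x → E t x → Agree k ζ ζ' M t N x)
    (huM : ∀ x y z, M.R x z → M.R y z → x = y) (huN : ∀ x y z, N.R x z → N.R y z → x = y)
    (hV : ∀ p, s ∈ M.V p ↔ w ∈ N.V p) {α β : Ordinal.{u}}
    (hle : ∀ x, N.R w x → #(N.succs x) ≤ ℵ_ ζ') (hζ : collapse A m (ℵ_ ζ) = ℵ_ ζ')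
    (hα : collapse A m (ℵ_ α) = ℵ_ β)
    (hG : ℵ₀ ≤ #(M.grandSuccs s) → #(M.grandSuccs s) = ℵ_ ζ)
    (hreg : M.HasRegularCards) : Agree (k + 1) α β M s N w := by
  have hφ : ∀ φ : Formula P, φ.deg < k + 1 → ∀ t x, M.R s t → N.R w x → E t x →
      (M.Holds φ t ↔ N.Holds φ x) := fun φ hd t x ht hx htx =>
    (hE t x ht hx htx).holds φ (Nat.lt_succ_iff.1 hd)
  refine ⟨fun φ => ?_, fun φ hd => ?_, fun φ hd => ?_, fun φ hd => ?_⟩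
  · induction φ with
    | atom p => exact fun _ => hV p
    | neg φ ih => exact fun hd => not_congr (ih hd)
    | and φ ψ ih ih' =>
      exact fun hd => and_congr (ih ((le_max_left _ _).trans hd))
        (ih' ((le_max_right _ _).trans hd))
    | box φ _ =>
      intro hd
      exact h.holds_box (hφ φ hd)
    | boxbox φ _ =>
      intro hd
      have hd' : φ.deg < k := by simp only [Formula.deg] at hd; omega
      have hk : 0 < k := by omega
      have hfin := h.mk_grandSuccs_lt hk hE huM huN
      simp only [Holds]
      rcases lt_or_ge #(M.grandSuccs s) ℵ₀ with hlt | hinf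
      · have hlt' := hfin.1 hlt
        simp only [hlt, hlt', not_le.2 hlt, not_le.2 hlt', false_and, true_and, false_or]
        have := not_congr (h.exists_iff (Q := fun t => ¬ M.count t (M.Holds (.neg φ)) = 0)
          (Q' := fun x => ¬ N.count x (N.Holds (.neg φ)) = 0)
          fun t x ht hx htx => not_congr ((hE t x ht hx htx).zero (.neg φ) hd'))
        push Not at this
        simp only [count_eq_zero, Holds, not_not] at this
        exact ⟨fun h1 x y hx => this.1 (fun t ht y => h1 t y ht) x hx y,
          fun h1 x y hx => this.2 (fun t ht y => h1 t y ht) x hx y⟩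
      · have hinf' : ℵ₀ ≤ #(N.grandSuccs w) := not_lt.1 fun h' => not_lt.2 hinf (hfin.2 h')
        simp only [hinf, hinf', not_lt.2 hinf, not_lt.2 hinf', true_and, false_and, or_false]
        have hM := hG hinf
        have hN := h.mk_grandSuccs_eq hk hE huM huN hle hζ hM (hM ▸ hreg s hinf)
        rw [h.level_eq hE hζ hM hN hd']
        have := h.level_eq hE hζ hM hN (φ := .neg φ) hd'
        change M.level s (fun x => ¬ M.Holds φ x) = N.level w (fun x => ¬ N.Holds φ x) at this
        rw [this]
  · rw [(h.count_eq _ _ (hφ φ hd)).1, collapse_eq_zero]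
  · rw [(h.count_eq _ _ (hφ φ hd)).1, collapse_lt_aleph0]
  · exact h.le_count_iff (hφ φ hd) hα

end Step

/-! ### Embeddings onto generated submodels -/

section Embedding

variable {M N : KripkeModel.{u, v} P} {g : M.World → N.World}

theorem count_of_embedding (hg : Function.Injective g)
    (hR : ∀ x y, N.R (g x) y ↔ ∃ z, M.R x z ∧ g z = y) (x : M.World)
    (Q : N.World → Prop) : N.count (g x) Q = M.count x (fun z => Q (g z)) := by
  symm
  refine Cardinal.mk_congr (Equiv.ofBijective
    (fun z => ⟨g z.1, (hR _ _).2 ⟨z.1, z.2.1, rfl⟩, z.2.2⟩) ⟨fun z z' h => ?_, fun y => ?_⟩)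
  · simp only [Subtype.mk.injEq] at h
    exact Subtype.ext (hg h)
  · obtain ⟨y, hy, hQ⟩ := y
    obtain ⟨z, hz, rfl⟩ := (hR _ _).1 hy
    exact ⟨⟨z, hz, hQ⟩, rfl⟩

theorem mk_grandSuccs_of_embedding (hg : Function.Injective g)
    (hR : ∀ x y, N.R (g x) y ↔ ∃ z, M.R x z ∧ g z = y) (x : M.World) :
    #(N.grandSuccs (g x)) = #(M.grandSuccs x) := by
  have : N.grandSuccs (g x) = g '' M.grandSuccs x := by
    ext y
    constructor
    · rintro ⟨t, ht, hy⟩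
      obtain ⟨t, ht', rfl⟩ := (hR _ _).1 ht
      obtain ⟨z, hz, rfl⟩ := (hR _ _).1 hy
      exact ⟨z, ⟨t, ht', hz⟩, rfl⟩
    · rintro ⟨z, ⟨t, ht, hz⟩, rfl⟩
      exact ⟨g t, (hR x _).2 ⟨t, ht, rfl⟩, (hR t _).2 ⟨z, hz, rfl⟩⟩
  rw [this, Cardinal.mk_image_eq hg]

theorem exists_of_embedding (hR : ∀ x y, N.R (g x) y ↔ ∃ z, M.R x z ∧ g z = y) (x : M.World)
    (Q : N.World → Prop) : (∃ y, N.R (g x) y ∧ Q y) ↔ ∃ z, M.R x z ∧ Q (g z) := by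
  constructor
  · rintro ⟨y, hy, hQ⟩
    obtain ⟨z, hz, rfl⟩ := (hR _ _).1 hy
    exact ⟨z, hz, hQ⟩
  · rintro ⟨z, hz, hQ⟩
    exact ⟨g z, (hR _ _).2 ⟨z, hz, rfl⟩, hQ⟩

theorem forall_of_embedding (hR : ∀ x y, N.R (g x) y ↔ ∃ z, M.R x z ∧ g z = y) (x : M.World)
    (Q : N.World → Prop) : (∀ y, N.R (g x) y → Q y) ↔ ∀ z, M.R x z → Q (g z) := by
  have := not_congr (exists_of_embedding hR x fun y => ¬ Q y)
  push Not at this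
  exact this

theorem level_of_embedding (hg : Function.Injective g)
    (hR : ∀ x y, N.R (g x) y ↔ ∃ z, M.R x z ∧ g z = y) (x : M.World)
    (Q : N.World → Prop) : N.level (g x) Q = M.level x (fun z => Q (g z)) := by
  unfold level
  rw [mk_grandSuccs_of_embedding hg hR]
  refine ite_congr_of_iff ?_ (ite_congr_of_iff ?_ (ite_congr_of_iff ?_ rfl)) <;>
    simp only [count_of_embedding hg hR, exists_of_embedding hR]

theorem holds_of_embedding (hg : Function.Injective g)
    (hR : ∀ x y, N.R (g x) y ↔ ∃ z, M.R x z ∧ g z = y) (hV : ∀ p x, g x ∈ N.V p ↔ x ∈ M.V p)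
    (φ : Formula P) : ∀ x, N.Holds φ (g x) ↔ M.Holds φ x := by
  induction φ with
  | atom p => exact hV p
  | neg φ ih => exact fun x => not_congr (ih x)
  | and φ ψ ih ih' => exact fun x => and_congr (ih x) (ih' x)
  | box φ ih =>
    intro x
    simp only [Holds, ← count_true, count_of_embedding hg hR, forall_of_embedding hR, ih]
  | boxbox φ ih =>
    intro x
    have : (∀ t y, N.R (g x) t → N.R t y → N.Holds φ y) ↔
        ∀ t z, M.R x t → M.R t z → M.Holds φ z := by
      constructor
      · exact fun h t z ht hz =>
          (ih z).1 (h (g t) (g z) ((hR x _).2 ⟨t, ht, rfl⟩) ((hR t _).2 ⟨z, hz, rfl⟩))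
      · intro h t y ht hy
        obtain ⟨t, ht', rfl⟩ := (hR _ _).1 ht
        obtain ⟨z, hz, rfl⟩ := (hR _ _).1 hy
        exact (ih z).2 (h t z ht' hz)
    simp only [Holds, level_of_embedding hg hR, mk_grandSuccs_of_embedding hg hR, ih, this]

theorem agree_of_embedding (hg : Function.Injective g)
    (hR : ∀ x y, N.R (g x) y ↔ ∃ z, M.R x z ∧ g z = y) (hV : ∀ p x, g x ∈ N.V p ↔ x ∈ M.V p)
    (k : ℕ) (α : Ordinal.{u}) (x : M.World) : Agree k α α M x N (g x) := by
  have hc : ∀ φ, N.count (g x) (N.Holds φ) = M.count x (M.Holds φ) := fun φ => by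
    rw [count_of_embedding hg hR]
    simp only [holds_of_embedding hg hR hV]
  refine ⟨fun φ _ => (holds_of_embedding hg hR hV φ x).symm, fun φ _ => ?_, fun φ _ => ?_,
    fun φ _ => ?_⟩ <;> rw [hc]

end Embedding

/-! ### Joining models under a new root -/

/-- The accessibility relation of the join of a family of pointed models under a new root. -/
inductive JoinRel {I : Type u} (K : I → KripkeModel.{u, v} P) (w : ∀ i, (K i).World) :
    Option (Σ i, (K i).World) → Option (Σ i, (K i).World) → Prop
  | root (i : I) : JoinRel K w none (some ⟨i, w i⟩)
  | step (i : I) (x y : (K i).World) : (K i).R x y → JoinRel K w (some ⟨i, x⟩) (some ⟨i, y⟩)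

/-- The join of a family of pointed models under a new root at which the propositions in `V₀`
are true. -/
def join (V₀ : Set P) {I : Type u} (K : I → KripkeModel.{u, v} P) (w : ∀ i, (K i).World) :
    KripkeModel.{u, v} P where
  World := Option (Σ i, (K i).World)
  nonempty := ⟨none⟩
  R := JoinRel K w
  V p := {x | x.elim (p ∈ V₀) fun y => y.2 ∈ (K y.1).V p}

section Join

variable {V₀ : Set P} {I : Type u} {K : I → KripkeModel.{u, v} P} {w : ∀ i, (K i).World}

/-- The inclusion of a member of the family into the join. -/
def joinIncl (V₀ : Set P) (K : I → KripkeModel.{u, v} P) (w : ∀ i, (K i).World) (i : I)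
    (x : (K i).World) : (join V₀ K w).World := some ⟨i, x⟩

theorem join_R_root {y : (join V₀ K w).World} :
    (join V₀ K w).R none y ↔ ∃ i, joinIncl V₀ K w i (w i) = y := by
  constructor
  · rintro ⟨i⟩
    exact ⟨i, rfl⟩
  · rintro ⟨i, rfl⟩
    exact JoinRel.root i

theorem join_R_incl {i : I} (x : (K i).World) (y : (join V₀ K w).World) :
    (join V₀ K w).R (joinIncl V₀ K w i x) y ↔ ∃ z, (K i).R x z ∧ joinIncl V₀ K w i z = y := by
  constructor
  · rintro ⟨⟩
    exact ⟨_, ‹_›, rfl⟩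
  · rintro ⟨z, hz, rfl⟩
    exact JoinRel.step i x z hz

theorem joinIncl_injective (i : I) : Function.Injective (joinIncl V₀ K w i) := by
  intro x y h
  have h' : (⟨i, x⟩ : Σ i, (K i).World) = ⟨i, y⟩ := Option.some.inj h
  cases h'
  rfl

theorem join_isTreeLike (h : ∀ i, (K i).IsTreeLike (w i)) :
    (join V₀ K w).IsTreeLike none := by
  refine ⟨?_, ?_, ?_⟩
  · rintro (_ | ⟨i, x⟩)
    · exact Relation.ReflTransGen.refl
    · refine Relation.ReflTransGen.head (b := joinIncl V₀ K w i (w i)) (JoinRel.root i) ?_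
      exact Relation.ReflTransGen.lift (joinIncl V₀ K w i)
        (fun a b hab => JoinRel.step i a b hab) _ _ ((h i).reachable x)
  · rintro x ⟨⟩
  · rintro x y z hx hy
    cases hx with
    | root i =>
      generalize hz : (some ⟨i, w i⟩ : Option (Σ i, (K i).World)) = z at hy
      cases hy with
      | root j => rfl
      | step j a b hab =>
        simp only [Option.some.injEq, Sigma.mk.injEq] at hz
        obtain ⟨rfl, hz⟩ := hz
        obtain rfl := eq_of_heq hz
        exact absurd hab ((h _).root _)
    | step i a b hab =>
      generalize hz : (some ⟨i, b⟩ : Option (Σ i, (K i).World)) = z at hy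
      cases hy with
      | root j =>
        simp only [Option.some.injEq, Sigma.mk.injEq] at hz
        obtain ⟨rfl, hz⟩ := hz
        obtain rfl := eq_of_heq hz
        exact absurd hab ((h _).root _)
      | step j a' b' hab' =>
        simp only [Option.some.injEq, Sigma.mk.injEq] at hz
        obtain ⟨rfl, hz⟩ := hz
        obtain rfl := eq_of_heq hz
        rw [(h _).unique_pred _ _ _ hab hab']

theorem join_agree (k : ℕ) (α : Ordinal.{u}) (i : I) (x : (K i).World) :
    Agree k α α (K i) x (join V₀ K w) (joinIncl V₀ K w i x) :=
  agree_of_embedding (joinIncl_injective i) (fun x y => join_R_incl x y) (fun _ _ => Iff.rfl) k α x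

theorem mk_succs_joinIncl (i : I) (x : (K i).World) :
    #((join V₀ K w).succs (joinIncl V₀ K w i x)) = #((K i).succs x) := by
  rw [← count_true, ← count_true,
    count_of_embedding (joinIncl_injective i) (fun x y => join_R_incl x y)]

theorem count_join_root (Q : (join V₀ K w).World → Prop) :
    (join V₀ K w).count none Q = #{i // Q (joinIncl V₀ K w i (w i))} := by
  symm
  refine Cardinal.mk_congr (Equiv.ofBijective
    (fun i => ⟨joinIncl V₀ K w i.1 (w i.1), join_R_root.2 ⟨i.1, rfl⟩, i.2⟩)
    ⟨fun i j h => ?_, fun y => ?_⟩)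
  · have h' : (⟨i.1, w i.1⟩ : Σ i, (K i).World) = ⟨j.1, w j.1⟩ :=
      Option.some.inj (congrArg Subtype.val h)
    exact Subtype.ext (congrArg Sigma.fst h')
  · obtain ⟨y, hy, hQ⟩ := y
    obtain ⟨i, rfl⟩ := join_R_root.1 hy
    exact ⟨⟨i, hQ⟩, rfl⟩

end Join

/-! ### Building the small model by induction on the degree -/

theorem sum_lt_of_finite {T : Type u} [Finite T] {c : Cardinal.{u}} (hc : ℵ₀ ≤ c)
    {f : T → Cardinal.{u}} (h : ∀ τ, f τ < c) : Cardinal.sum f < c := by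
  have hT : #T < ℵ₀ := Cardinal.lt_aleph0_of_finite T
  refine (Cardinal.sum_le_mk_mul_iSup f).trans_lt (Cardinal.mul_lt_of_lt hc (hT.trans_le hc) ?_)
  refine Cardinal.iSup_lt_of_lt_cof_ord (hT.trans_le ?_) h
  exact (isRegular_cof (Cardinal.isSuccLimit_ord hc)).aleph0_le

/-- The model consisting of a single world without successors. -/
def single (V₀ : Set P) : KripkeModel.{u, v} P where
  World := PUnit
  nonempty := ⟨⟨⟩⟩
  R _ _ := False
  V p := {_x | p ∈ V₀}

theorem single_isTreeLike (V₀ : Set P) : (single.{u, v} V₀).IsTreeLike ⟨⟩ :=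
  ⟨fun _ => Relation.ReflTransGen.refl, fun _ h => h, fun _ _ _ h => h.elim⟩

theorem mk_single_lt (V₀ : Set P) : #(single.{u, v} V₀).World < ℵ_ ω := by
  change #PUnit < _
  rw [Cardinal.mk_punit]
  exact one_lt_aleph0.trans_le (aleph0_le_aleph _)

theorem exists_agree_of_types [Nonempty P] {M : KripkeModel.{u, v} P} {s : M.World}
    (huM : ∀ x y z, M.R x z → M.R y z → x = y) (hreg : M.HasRegularCards) {k : ℕ}
    {α ζ : Ordinal.{u}} (hα : #(M.succs s) ≤ ℵ_ α)
    (hG : ℵ₀ ≤ #(M.grandSuccs s) → #(M.grandSuccs s) = ℵ_ ζ)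
    {T : Type u} [Finite T] (tp : M.succs s → T) (m : ℕ)
    (H : ∀ n, m ≤ n → ∀ τ : T, ∃ (K : KripkeModel.{u, v} P) (w : K.World), K.IsTreeLike w ∧
      #K.World < ℵ_ ω ∧ #(K.succs w) ≤ ℵ_ (n : Ordinal.{u}) ∧
      ∀ t : M.succs s, tp t = τ → Agree k ζ (n : Ordinal.{u}) M t.1 K w) :
    ∃ m' : ℕ, ∀ n : ℕ, m' ≤ n → ∃ (N : KripkeModel.{u, v} P) (w : N.World), N.IsTreeLike w ∧
      #N.World < ℵ_ ω ∧ #(N.succs w) ≤ ℵ_ (n : Ordinal.{u}) ∧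
      Agree (k + 1) α (n : Ordinal.{u}) M s N w := by
  classical
  -- Every property transferred to the new model is constant on types, so its count at `s` is the
  -- size of a union of types.
  let A : Finset Cardinal.{u} := (Set.finite_range fun B : Set T => #(tp ⁻¹' B)).toFinset
  have hA : ∀ B : Set T, #(tp ⁻¹' B) ∈ A := fun B => by simp [A]
  refine ⟨m + A.card, fun n hn => ?_⟩
  have hr : (A.filter (· < ℵ_ α)).card ≤ A.card := Finset.card_filter_le _ _
  -- The base index is chosen to send `ℵ_ α` exactly to `ℵ_ n`. Since at most `A.card` is
  -- subtracted, `m ≤ n₀ ≤ n'`, so the representatives exist for the index `n'` of the image of `ℵ_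
  -- ζ`.
  set n₀ := n - (A.filter (· < ℵ_ α)).card with hn₀
  have hcα : collapse A n₀ (ℵ_ α) = ℵ_ (n : Ordinal.{u}) := by
    rw [collapse, if_neg (not_lt.2 (aleph0_le_aleph _)), hn₀, Nat.sub_add_cancel (by omega)]
  set n' := n₀ + (A.filter (· < ℵ_ ζ)).card with hn'
  have hcζ : collapse A n₀ (ℵ_ ζ) = ℵ_ (n' : Ordinal.{u}) := by
    rw [collapse, if_neg (not_lt.2 (aleph0_le_aleph _))]
  choose K w htree hcard hsucc hagree using H n' (by omega)
  let I : Type u := Σ τ : T, (collapse A n₀ #(tp ⁻¹' {τ})).out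
  let V₀ : Set P := {p | s ∈ M.V p}
  let N := join V₀ (fun i : I => K i.1) (fun i => w i.1)
  have htreeN : N.IsTreeLike none := join_isTreeLike fun i => htree i.1
  have hfib : ∀ τ, #((fun i : I => i.1) ⁻¹' {τ}) = collapse A n₀ #(tp ⁻¹' {τ}) := fun τ => by
    rw [← Cardinal.mk_out (collapse A n₀ #(tp ⁻¹' {τ}))]
    refine Cardinal.mk_congr (Equiv.ofBijective (β := (collapse A n₀ #(tp ⁻¹' {τ})).out)
      (fun i => (show i.1.1 = τ from i.2) ▸ i.1.2) ⟨?_, fun x => ⟨⟨⟨τ, x⟩, rfl⟩, rfl⟩⟩)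
    rintro ⟨⟨i, x⟩, hi⟩ ⟨⟨j, y⟩, hj⟩ hxy
    obtain rfl : i = τ := hi
    obtain rfl : j = i := hj
    obtain rfl : x = y := hxy
    rfl
  have hpre := collapse_preimage hfib
  let E : M.World → N.World → Prop := fun t x =>
    ∃ (i : I) (h : M.R s t), x = joinIncl _ _ _ i (w i.1) ∧ tp ⟨t, h⟩ = i.1
  have hne : ∀ i : I, ∃ t, tp t = i.1 := fun i => by
    have : #(tp ⁻¹' {i.1}) ≠ 0 := by
      rw [Ne, ← collapse_eq_zero (A := A) (m := n₀), ← hfib]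
      exact Cardinal.mk_ne_zero_iff.2 ⟨⟨i, rfl⟩⟩
    obtain ⟨t, ht⟩ := Cardinal.mk_ne_zero_iff.1 this
    exact ⟨t, ht⟩
  have hne' : ∀ t, ∃ i : I, tp t = i.1 := fun t => by
    have : #((fun i : I => i.1) ⁻¹' {tp t}) ≠ 0 := by
      rw [hfib, Ne, collapse_eq_zero]
      exact Cardinal.mk_ne_zero_iff.2 ⟨⟨t, rfl⟩⟩
    obtain ⟨i, hi⟩ := Cardinal.mk_ne_zero_iff.1 this
    exact ⟨i, hi.symm⟩
  have hmatch : Matching A n₀ M s N none E := by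
    refine ⟨fun x hx => ?_, fun Q Q' hQ => ?_⟩
    · obtain ⟨i, rfl⟩ := join_R_root.1 hx
      obtain ⟨t, ht⟩ := hne i
      exact ⟨t.1, t.2, i, t.2, rfl, ht⟩
    -- `Q` is constant on types: each realised type has a copy in `N`, and all `t` of that type
    -- agree with the truth value of `Q'` there.
    · let B : Set T := {τ | ∃ t, tp t = τ ∧ Q t.1}
      have hQQ : ∀ (t : M.succs s) (i : I), tp t = i.1 →
          (Q t.1 ↔ Q' (joinIncl _ _ _ i (w i.1))) := fun t i hti =>
        hQ _ _ t.2 (join_R_root.2 ⟨i, rfl⟩) ⟨i, t.2, rfl, hti⟩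
      have h1 : {t : M.succs s | Q t.1} = tp ⁻¹' B := by
        ext t
        refine ⟨fun h => ⟨t, rfl, h⟩, ?_⟩
        rintro ⟨t', ht', hq⟩
        obtain ⟨i, hi⟩ := hne' t
        exact (hQQ t i hi).2 ((hQQ t' i (ht'.trans hi)).1 hq)
      have h2 : {i : I | Q' (joinIncl _ _ _ i (w i.1))} = (fun i : I => i.1) ⁻¹' B := by
        ext i
        constructor
        · intro h
          obtain ⟨t, ht⟩ := hne i
          exact ⟨t, ht, (hQQ t i ht).2 h⟩
        · rintro ⟨t, ht, hq⟩
          exact (hQQ t i ht).1 hq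
      have h1' : M.count s Q = #(tp ⁻¹' B) := by
        rw [← h1, count_eq_mk_succs]; rfl
      have h2' : N.count none Q' = #((fun i : I => i.1) ⁻¹' B) := by
        rw [← h2, count_join_root]; rfl
      rw [h1', h2']
      exact ⟨hpre B, hA B⟩
  have hE : ∀ t x, M.R s t → N.R none x → E t x → Agree k ζ (n' : Ordinal.{u}) M t N x := by
    rintro t x ht - ⟨i, _, rfl, hi⟩
    exact (hagree i.1 ⟨t, ht⟩ hi).trans (join_agree (K := fun i : I => K i.1) k _ i _)
  have hle : ∀ x, N.R none x → #(N.succs x) ≤ ℵ_ (n' : Ordinal.{u}) := by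
    intro x hx
    obtain ⟨i, rfl⟩ := join_R_root.1 hx
    exact (mk_succs_joinIncl (K := fun i : I => K i.1) i _).trans_le (hsucc i.1)
  have hω : ∀ j : ℕ, ℵ_ (j : Ordinal.{u}) < ℵ_ ω := fun j =>
    aleph_lt_aleph.2 (natCast_lt_omega0 j)
  refine ⟨N, none, htreeN, ?_, ?_, hmatch.agree hE huM htreeN.unique_pred (fun p => Iff.rfl) hle
    hcζ hcα hG hreg⟩
  · have hinf := aleph0_le_aleph.{u} ω
    have e : #(Σ i : I, (K i.1).World) =
        Cardinal.sum fun τ => collapse A n₀ #(tp ⁻¹' {τ}) * #(K τ).World := by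
      rw [(Equiv.sigmaAssoc fun τ (_ : (collapse A n₀ #(tp ⁻¹' {τ})).out) =>
        (K τ).World).cardinal_eq, Cardinal.mk_sigma]
      congr 1
      funext τ
      simp
    change #(Option (Σ i : I, (K i.1).World)) < _
    rw [Cardinal.mk_option, e]
    -- `ℵ_ ω` is singular, so the finiteness of `T` is what keeps the sum below it.
    refine Cardinal.add_lt_of_lt hinf (sum_lt_of_finite hinf fun τ =>
      Cardinal.mul_lt_of_lt hinf ?_ (hcard τ)) (one_lt_aleph0.trans_le hinf)
    unfold collapse
    split_ifs with h
    · exact h.trans_le hinf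
    · exact hω _
  · rw [hmatch.mk_succs, ← hcα]
    exact collapse_mono hα

/-- The bound on `N.succs w` is carried along because the next stage needs it to bound the number of
grandsuccessors, and the logarithms need it at the end. -/
theorem exists_agree [Finite P] [Nonempty P] {M : KripkeModel.{u, v} P}
    (huM : ∀ x y z, M.R x z → M.R y z → x = y) (hreg : M.HasRegularCards) (k : ℕ) :
    ∀ (s : M.World) (α : Ordinal.{u}), #(M.succs s) ≤ ℵ_ α →
    ∃ m : ℕ, ∀ n : ℕ, m ≤ n → ∃ (N : KripkeModel.{u, v} P) (w : N.World), N.IsTreeLike w ∧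
      #N.World < ℵ_ ω ∧ #(N.succs w) ≤ ℵ_ (n : Ordinal.{u}) ∧
      Agree k α (n : Ordinal.{u}) M s N w := by
  induction k with
  | zero =>
    refine fun s α _ => ⟨0, fun n _ => ⟨single {p | s ∈ M.V p}, ⟨⟩, single_isTreeLike _,
      mk_single_lt _, ?_, fun φ hφ => ?_, ?_, ?_, ?_⟩⟩
    · refine le_trans (le_of_eq ?_) (zero_le (a := ℵ_ (n : Ordinal.{u})))
      exact Cardinal.mk_eq_zero_iff.2 ⟨fun x => x.2⟩
    · induction φ with
      | atom p => exact Iff.rfl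
      | neg φ ih => exact not_congr (ih hφ)
      | and φ ψ ih ih' =>
        exact and_congr (ih ((le_max_left _ _).trans hφ)) (ih' ((le_max_right _ _).trans hφ))
      | box φ _ => simp [Formula.deg] at hφ
      | boxbox φ _ => simp [Formula.deg] at hφ
    all_goals exact fun φ hφ => absurd hφ (Nat.not_lt_zero _)
  | succ k ih =>
    intro s α hα
    obtain ⟨ζ, hζ, hG⟩ : ∃ ζ : Ordinal.{u}, #(M.grandSuccs s) ≤ ℵ_ ζ ∧
        (ℵ₀ ≤ #(M.grandSuccs s) → #(M.grandSuccs s) = ℵ_ ζ) := by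
      rcases lt_or_ge #(M.grandSuccs s) ℵ₀ with h | h
      · exact ⟨0, h.le.trans (aleph0_le_aleph 0), fun h' => absurd h (not_lt.2 h')⟩
      · obtain ⟨ζ, hζ⟩ := mem_range_aleph_iff.2 h
        exact ⟨ζ, hζ.ge, fun _ => hζ.symm⟩
    obtain ⟨T, _, tp, htp⟩ := M.exists_finite_types k ζ
    -- Keeping only the realised types gives each one a representative, to which the induction
    -- hypothesis applies; finitely many types allow a common bound `m'`.
    let tp' : M.succs s → Set.range fun t : M.succs s => tp t.1 := Set.rangeFactorization _
    have hsurj : Function.Surjective tp' := Set.rangeFactorization_surjective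
    choose rep hrep using hsurj
    choose m hm using fun τ => ih (rep τ).1 ζ ((mk_succs_le_mk_grandSuccs (rep τ).2).trans hζ)
    obtain ⟨m', hm'⟩ := Finite.exists_le m
    refine exists_agree_of_types huM hreg hα hG tp' m' fun n hn τ => ?_
    obtain ⟨K, w, h1, h2, h3, h4⟩ := hm τ n ((hm' τ).trans hn)
    refine ⟨K, w, h1, h2, h3, fun t ht => Agree.trans (htp _ _ ?_) h4⟩
    exact congrArg Subtype.val (ht.trans (hrep τ).symm)

/-! ### From agreement to modal equivalence -/

/-- An infinite cardinal below `ℵ_ ω` is `ℵ₀` or a successor aleph. -/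
theorem hasRegularCards_of_lt {N : KripkeModel.{u, v} P} (h : #N.World < ℵ_ ω) :
    N.HasRegularCards := by
  intro x hx
  obtain ⟨o, ho⟩ := mem_range_aleph_iff.2 hx
  have hlt : ℵ_ o < ℵ_ ω := ho ▸ (Cardinal.mk_set_le _).trans_lt h
  obtain ⟨j, rfl⟩ := lt_omega0.1 (aleph_lt_aleph.1 hlt)
  rw [← ho]
  cases j with
  | zero => simpa using isRegular_aleph0
  | succ j =>
    rw [Nat.cast_succ]
    exact isRegular_aleph_add_one _

theorem log_omega_ord {α : Ordinal.{u}} {c : Cardinal.{u}} (h : c ≤ ℵ_ α) :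
    Ordinal.log (ω_ α) c.ord = if ℵ_ α ≤ c then 1 else 0 := by
  have hω : 1 < ω_ α := one_lt_omega0.trans_le (omega0_le_omega α)
  split_ifs with hc
  · rw [le_antisymm h hc, ord_aleph]
    simpa using Ordinal.log_opow hω 1
  · refine Ordinal.log_eq_zero ?_
    rw [← ord_aleph]
    exact Cardinal.ord_lt_ord.2 (not_le.1 hc)

theorem Agree.modalEquiv {k : ℕ} {α β : Ordinal.{u}} {M N : KripkeModel.{u, v} P} {s : M.World}
    {w : N.World} (h : Agree k α β M s N w)
    (huM : ∀ x y z, M.R x z → M.R y z → x = y) (huN : ∀ x y z, N.R x z → N.R y z → x = y)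
    (hM : M.HasRegularCards) (hN : N.HasRegularCards)
    (hα : #(M.succs s) ≤ ℵ_ α) (hβ : #(N.succs w) ≤ ℵ_ β)
    (e : M.Enumeration) (e' : N.Enumeration) : ModalEquiv k α β M e s N e' w := by
  unfold ModalEquiv
  simp only [sat_iff_holds huM hM, sat_iff_holds huN hN]
  refine ⟨h.holds, fun φ hφ => ?_⟩
  change (¬ (∃ t, M.R s t ∧ M.Holds φ t) ∧ ¬ (∃ x, N.R w x ∧ N.Holds φ x)) ∨
    ((∃ t, M.R s t ∧ M.Holds φ t) ∧ (∃ x, N.R w x ∧ N.Holds φ x) ∧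
      Ordinal.log (ω_ α) (M.count s (M.Holds φ)).ord =
        Ordinal.log (ω_ β) (N.count w (N.Holds φ)).ord)
  rw [← count_ne_zero, ← count_ne_zero]
  have hz := h.zero φ hφ
  by_cases h0 : M.count s (M.Holds φ) = 0
  · exact Or.inl ⟨not_not.2 h0, not_not.2 (hz.1 h0)⟩
  · refine Or.inr ⟨h0, fun h1 => h0 (hz.2 h1), ?_⟩
    rw [log_omega_ord ((count_le_succs s _).trans hα),
      log_omega_ord ((count_le_succs w _).trans hβ)]
    simp only [h.top φ hφ]

end KripkeModel

end TransfiniteModal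

theorem mainTheorem2 {P : Type v} [Finite P]
    (M : TransfiniteModal.KripkeModel.{u, v} P) (s : M.World)
    (htree : M.IsTreeLike s) (hreg : M.HasRegularCards)
    (k : ℕ) (α : Ordinal.{u}) (hα : #(M.succs s) ≤ ℵ_ α) :
    ∃ m : ℕ, ∀ n : ℕ, m ≤ n →
      ∃ (N : TransfiniteModal.KripkeModel.{u, v} P) (w : N.World),
        N.IsTreeLike w ∧ #N.World < ℵ_ ω ∧
        ∀ (e : M.Enumeration) (e' : N.Enumeration),
          TransfiniteModal.KripkeModel.ModalEquiv k α (n : Ordinal.{u}) M e s N e' w := by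
  open TransfiniteModal KripkeModel in
  -- Without propositions there are no formulas, not even a tautology, and any model will do.
  rcases isEmpty_or_nonempty P with hP | hP
  · have hF : Formula P → False := fun φ => by
      induction φ with
      | atom p => exact hP.elim p
      | neg _ ih => exact ih
      | and _ _ ih _ => exact ih
      | box _ ih => exact ih
      | boxbox _ ih => exact ih
    exact ⟨0, fun n _ => ⟨single ∅, ⟨⟩, single_isTreeLike _, mk_single_lt _,
      fun _ _ => ⟨fun φ => (hF φ).elim, fun φ => (hF φ).elim⟩⟩⟩
  · obtain ⟨m, hm⟩ := exists_agree htree.unique_pred hreg k s α hα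
    refine ⟨m, fun n hn => ?_⟩
    obtain ⟨N, w, h1, h2, h3, h4⟩ := hm n hn
    exact ⟨N, w, h1, h2, fun e e' => h4.modalEquiv htree.unique_pred h1.unique_pred hreg
      (hasRegularCards_of_lt h2) hα h3 e e'⟩
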